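/- Let $p\colon E\to B$ be a Hurewicz fibration (a continuous map with the homotopy lifting property for all spaces) whose fibres are all non-empty and path-connected. Let $E\times_B E=\{(e,e')\in E\times E : p(e)=p(e')\}$, and let $E_B^I$ be the space, with the compact-open topology, of continuous paths $\gamma\colon [0,1]\to E$ for which $p\circ\gamma$ is constant. The parametrised topological complexity $\mathrm{tc}[p\colon E\to B]$ is the smallest integer $k\ge 0$ such that $E\times_B E$ has an open cover $U_0\cup U_1\cup\dots\cup U_k$ over each member of which the map $\Pi\colon E_B^I\to E\times_B E$, $\gamma\mapsto(\gamma(0),\gamma(1))$, has a continuous section; it is $\infty$ if there is no such $k$. Let $R$ be an arbitrary ring with unit, let $H^*(-;R)$ be the singular cohomology ring with the cup product, and let $\Delta\colon E\to E\times_B E$, $\Delta(e)=(e,e)$, be the diagonal map. Then $\mathrm{tc}[p\colon E\to B]$ is greater than or equal to the cup length of $$\ker[\Delta^*\colon H^*(E\times_B E;R)\to H^*(E;R)],$$ that is, the supremum of the integers $k \ge 0$ for which some product of $k$ elements of this kernel is nonzero. In other words, if $u_1,\dots,u_k\in H^*(E\times_B E;R)$ satisfy $\Delta^*(u_i)=0$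 for $i=1,\dots,k$ and $$u_1\smile u_2\smile\dots\smile u_k\ne 0\in H^*(E\times_B E;R),$$ then $\mathrm{tc}[p\colon E\to B]\ge k$. -/

import Mathlib

universe u v w

noncomputable section

/-! ### The cohomology ring of a simplicial set -/

namespace SimplicialCohomology

open CategoryTheory Opposite

variable (K : SSet.{u}) (R : Type v) [Ring R]

section

open scoped Simplicial

/-- The monotone map `[p] → [n]`, `i ↦ a + i`. -/
def segHom {p n : ℕ} (a : ℕ) (h : a + p ≤ n) : ⦋p⦌ ⟶ ⦋n⦌ :=
  SimplexCategory.mkHom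
    { toFun := fun i => ⟨a + i.1, by have := i.2; omega⟩
      monotone' := fun i j hij => by
        simp only [Fin.mk_le_mk]
        have : i.1 ≤ j.1 := hij
        omega }

/-- The face of an `n`-simplex spanned by its vertices `a, a + 1, …, a + p`. For `a = 0` it is the
front `p`-face, for `a + p = n` it is the back `p`-face. -/
def seg {p n : ℕ} (a : ℕ) (h : a + p ≤ n) (x : K _⦋n⦌) : K _⦋p⦌ :=
  K.map (segHom a h).op x

/-- `R`-valued `n`-cochains: functions on the set of `n`-simplices. -/
abbrev Cochain (n : ℕ) : Type (max u v) := K _⦋n⦌ → R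

/-- The coboundary `(dφ)(x) = ∑ᵢ (-1)ⁱ φ(∂ᵢ x)`. -/
def d (n : ℕ) : Cochain K R n →+ Cochain K R (n + 1) where
  toFun φ x := ∑ i : Fin (n + 2), (-1 : R) ^ (i : ℕ) * φ (K.δ i x)
  map_zero' := by ext x; simp
  map_add' φ ψ := by ext x; simp [mul_add, Finset.sum_add_distrib]

end

/-- Cocycles. -/
def cocycles (n : ℕ) : AddSubgroup (Cochain K R n) := (d K R n).ker

/-- Coboundaries. -/
def coboundaries : (n : ℕ) → AddSubgroup (Cochain K R n)
  | 0 => ⊥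
  | n + 1 => (d K R n).range

/-- The cohomology group `Hⁿ(K; R)`: cocycles modulo coboundaries. -/
def Cohomology (n : ℕ) : Type (max u v) :=
  cocycles K R n ⧸ (coboundaries K R n).addSubgroupOf (cocycles K R n)

instance (n : ℕ) : AddCommGroup (Cohomology K R n) :=
  inferInstanceAs (AddCommGroup (cocycles K R n ⧸ _))

/-- The class of a cocycle. -/
def Cohomology.mk (n : ℕ) : cocycles K R n →+ Cohomology K R n :=
  QuotientAddGroup.mk' _

variable {K R}

section

open scoped Simplicial

/-- The cup product of cochains, `(φ ⌣ ψ)(x) = φ(front p-face of x) ψ(back q-face of x)`. -/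
def cup {p q n : ℕ} (h : p + q = n) (φ : Cochain K R p) (ψ : Cochain K R q) : Cochain K R n :=
  fun x => φ (seg K 0 (by omega) x) * ψ (seg K p (by omega) x)

lemma segHom_val {p n a : ℕ} (h : a + p ≤ n) (i : Fin (p + 1)) :
    ((segHom a h).toOrderHom i).val = a + i.val := rfl

lemma δ_val {n : ℕ} (i : Fin (n + 2)) (j : Fin (n + 1)) :
    (j.val < i.val ∧ ((SimplexCategory.δ i).toOrderHom j).val = j.val) ∨
      (i.val ≤ j.val ∧ ((SimplexCategory.δ i).toOrderHom j).val = j.val + 1) := by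
  change (_ ∧ (i.succAbove j).val = _) ∨ (_ ∧ (i.succAbove j).val = _)
  simp only [Fin.succAbove, Fin.lt_def, Fin.val_castSucc]
  split_ifs <;> simp <;> omega

lemma seg_seg {p m n a b : ℕ} (h : a + p ≤ m) (h' : b + m ≤ n) (x : K _⦋n⦌) :
    seg K a h (seg K b h' x) = seg K (b + a) (by omega) x := by
  simp only [seg]
  rw [← Functor.map_comp_apply, ← op_comp]
  congr 4
  ext i
  simp only [SimplexCategory.comp_toOrderHom, OrderHom.comp_coe, Function.comp, segHom_val]
  omega

lemma seg_zero_self {n : ℕ} (h : 0 + n ≤ n) (x : K _⦋n⦌) : seg K 0 h x = x := by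
  have : segHom 0 h = 𝟙 ⦋n⦌ := by
    ext i
    rw [segHom_val]
    simp
  simp [seg, this]

lemma seg_δ_le {p n a : ℕ} (h : a + p ≤ n) (i : Fin (n + 2)) (hi : i.1 ≤ a) (x : K _⦋n + 1⦌) :
    seg K a h (K.δ i x) = seg K (a + 1) (by omega) x := by
  simp only [seg, SimplicialObject.δ_def]
  rw [← Functor.map_comp_apply, ← op_comp]
  congr 4
  ext j
  simp only [SimplexCategory.comp_toOrderHom, OrderHom.comp_coe, Function.comp, segHom_val]
  have h1 := δ_val i ((segHom a h).toOrderHom j)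
  rw [segHom_val] at h1
  omega

lemma seg_δ_gt {p n a : ℕ} (h : a + p ≤ n) (i : Fin (n + 2)) (hi : a + p < i.1)
    (x : K _⦋n + 1⦌) :
    seg K a h (K.δ i x) = seg K a (by omega) x := by
  simp only [seg, SimplicialObject.δ_def]
  rw [← Functor.map_comp_apply, ← op_comp]
  congr 4
  ext j
  have hj : j.val < p + 1 := j.2
  simp only [SimplexCategory.comp_toOrderHom, OrderHom.comp_coe, Function.comp, segHom_val]
  have h1 := δ_val i ((segHom a h).toOrderHom j)
  rw [segHom_val] at h1
  omega

lemma δ_seg {p n a : ℕ} (h : a + (p + 1) ≤ n + 1) (i : Fin (p + 2)) (i' : Fin (n + 2))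
    (hi : i'.1 = a + i.1) (x : K _⦋n + 1⦌) :
    K.δ i (seg K a h x) = seg K a (by omega) (K.δ i' x) := by
  simp only [seg, SimplicialObject.δ_def]
  rw [← Functor.map_comp_apply, ← Functor.map_comp_apply, ← op_comp, ← op_comp]
  congr 4
  ext j
  simp only [SimplexCategory.comp_toOrderHom, OrderHom.comp_coe, Function.comp, segHom_val]
  have h1 := δ_val i j
  have h2 := δ_val i' ((segHom a (p := p) (n := n) (by omega)).toOrderHom j)
  rw [segHom_val] at h2
  omega

lemma neg_one_pow_mul_comm (i : ℕ) (a b : R) : a * ((-1) ^ i * b) = (-1) ^ i * (a * b) := by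
  rcases neg_one_pow_eq_or R i with h | h <;> simp [h]

lemma neg_one_pow_mul_comm' (i j : ℕ) (b : R) :
    (-1) ^ i * ((-1) ^ j * b) = (-1) ^ j * ((-1) ^ i * b) := neg_one_pow_mul_comm j _ b

/-- The Leibniz rule. -/
lemma d_cup {p q n : ℕ} (h : p + q = n) (φ : Cochain K R p) (ψ : Cochain K R q) :
    d K R n (cup h φ ψ) = cup (by omega) (d K R p φ) ψ +
      fun x => (-1) ^ p * cup (K := K) (by omega) φ (d K R q ψ) x := by
  ext x
  have hn : (p + 1) + (q + 1) = n + 2 := by omega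
  simp only [d, cup, AddMonoidHom.coe_mk, ZeroHom.coe_mk, Pi.add_apply]
  rw [← Fin.sum_congr' _ hn, Fin.sum_univ_add, Fin.sum_univ_castSucc (n := p + 1),
    Fin.sum_univ_succ (n := q + 1)]
  have h1 : ∀ i : Fin (p + 1),
      (-1 : R) ^ ((Fin.cast hn (Fin.castAdd (q + 1) i) : Fin (n + 2)) : ℕ) *
        (φ (seg K 0 (by omega) (K.δ (Fin.cast hn (Fin.castAdd (q + 1) i)) x)) *
          ψ (seg K p (by omega) (K.δ (Fin.cast hn (Fin.castAdd (q + 1) i)) x))) =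
      (-1 : R) ^ (i.castSucc : ℕ) * φ (K.δ i.castSucc (seg K 0 (by omega) x)) *
        ψ (seg K (p + 1) (by omega) x) := by
    intro i
    rw [δ_seg (n := n) (by omega) i.castSucc (Fin.cast hn (Fin.castAdd (q + 1) i)) (by simp),
      seg_δ_le (a := p) (by omega) _ (by have := i.2; simp; omega), mul_assoc]
    simp
  have h2 : ∀ i : Fin (q + 1),
      (-1 : R) ^ ((Fin.cast hn (Fin.natAdd (p + 1) i) : Fin (n + 2)) : ℕ) *
        (φ (seg K 0 (by omega) (K.δ (Fin.cast hn (Fin.natAdd (p + 1) i)) x)) *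
          ψ (seg K p (by omega) (K.δ (Fin.cast hn (Fin.natAdd (p + 1) i)) x))) =
      (-1 : R) ^ p * (φ (seg K 0 (by omega) x) *
        ((-1 : R) ^ (i.succ : ℕ) * ψ (K.δ i.succ (seg K p (by omega) x)))) := by
    intro i
    rw [δ_seg (n := n) (by omega) i.succ (Fin.cast hn (Fin.natAdd (p + 1) i)) (by simp; omega),
      seg_δ_gt (a := 0) (by omega) _ (by simp; omega), neg_one_pow_mul_comm, ← mul_assoc,
      ← mul_assoc, ← mul_assoc, ← pow_add]
    congr 3
    simp
    omega
  have h3 : K.δ (Fin.last (p + 1)) (seg K 0 (by omega) x) = seg K (p := p) 0 (by omega) x := by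
    rw [δ_seg (n := n) (by omega) _ ⟨p + 1, by omega⟩ (by simp), seg_δ_gt (by omega) _ (by simp)]
  have h4 : K.δ 0 (seg K p (by omega) x) = seg K (p := q) (p + 1) (by omega) x := by
    rw [δ_seg (n := n) (by omega) _ ⟨p, by omega⟩ (by simp), seg_δ_le (by omega) _ (by simp)]
  rw [Finset.sum_congr rfl (fun i _ => h1 i), Finset.sum_congr rfl (fun i _ => h2 i), h3, h4,
    add_mul, Finset.sum_mul, mul_add, mul_add, Finset.mul_sum, Finset.mul_sum]
  simp only [Fin.val_last, pow_succ, Fin.val_zero, pow_zero, one_mul, mul_assoc, neg_mul, mul_neg]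
  abel

end

lemma cup_zero_left {p q n : ℕ} (h : p + q = n) (ψ : Cochain K R q) :
    cup h (0 : Cochain K R p) ψ = 0 := by ext; simp [cup]

lemma cup_zero_right {p q n : ℕ} (h : p + q = n) (φ : Cochain K R p) :
    cup h φ (0 : Cochain K R q) = 0 := by ext; simp [cup]

lemma cup_mem_cocycles {p q n : ℕ} (h : p + q = n) {φ : Cochain K R p} {ψ : Cochain K R q}
    (hφ : φ ∈ cocycles K R p) (hψ : ψ ∈ cocycles K R q) : cup h φ ψ ∈ cocycles K R n := by
  have hφ' : d K R p φ = 0 := hφ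
  have hψ' : d K R q ψ = 0 := hψ
  change d K R n (cup h φ ψ) = 0
  rw [d_cup, hφ', hψ', cup_zero_left, cup_zero_right]
  ext; simp

lemma cup_mem_coboundaries_left {p q n : ℕ} (h : p + q = n) {φ : Cochain K R p}
    {ψ : Cochain K R q} (hφ : φ ∈ coboundaries K R p) (hψ : ψ ∈ cocycles K R q) :
    cup h φ ψ ∈ coboundaries K R n := by
  cases p with
  | zero =>
    have : φ = 0 := hφ
    rw [this, cup_zero_left]
    exact zero_mem _
  | succ p =>
    obtain ⟨m, rfl⟩ : ∃ m, n = m + 1 := ⟨p + q, by omega⟩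
    obtain ⟨θ, rfl⟩ := hφ
    have hψ' : d K R q ψ = 0 := hψ
    refine ⟨cup (by omega) θ ψ, ?_⟩
    rw [d_cup, hψ', cup_zero_right]
    ext; simp

lemma cup_mem_coboundaries_right {p q n : ℕ} (h : p + q = n) {φ : Cochain K R p}
    {ψ : Cochain K R q} (hφ : φ ∈ cocycles K R p) (hψ : ψ ∈ coboundaries K R q) :
    cup h φ ψ ∈ coboundaries K R n := by
  cases q with
  | zero =>
    have : ψ = 0 := hψ
    rw [this, cup_zero_right]
    exact zero_mem _
  | succ q =>
    obtain ⟨m, rfl⟩ : ∃ m, n = m + 1 := ⟨p + q, by omega⟩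
    obtain ⟨θ, rfl⟩ := hψ
    have hφ' : d K R p φ = 0 := hφ
    refine ⟨cup (by omega) (fun x => (-1) ^ p * φ x) θ, ?_⟩
    have hs : d K R p (fun x => (-1) ^ p * φ x) = 0 := by
      ext x
      have := congrFun hφ' x
      simp only [d, AddMonoidHom.coe_mk, ZeroHom.coe_mk, Pi.zero_apply] at this ⊢
      simp only [neg_one_pow_mul_comm' _ p]
      rw [← Finset.mul_sum, this, mul_zero]
    rw [d_cup, hs, cup_zero_left]
    ext x
    simp only [cup, zero_add, mul_assoc]
    rw [← mul_assoc, ← pow_add, Even.neg_one_pow ⟨p, rfl⟩, one_mul]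

/-- The cup product of cocycles. -/
def cocycleCup {p q n : ℕ} (h : p + q = n) :
    cocycles K R p →+ cocycles K R q →+ cocycles K R n :=
  AddMonoidHom.mk' (fun φ => AddMonoidHom.mk' (fun ψ => ⟨cup h φ.1 ψ.1, cup_mem_cocycles h φ.2 ψ.2⟩)
    (fun ψ ψ' => by ext x; simp [cup, mul_add]))
    (fun φ φ' => by ext ψ x; simp [cup, add_mul])

/-- The cup product `Hᵖ(K; R) × H^q(K; R) → Hⁿ(K; R)`, `p + q = n`, induced by the cup product of
cocycles. -/
def Cohomology.cup {p q n : ℕ} (h : p + q = n) :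
    Cohomology K R p →+ Cohomology K R q →+ Cohomology K R n :=
  QuotientAddGroup.lift _
    (AddMonoidHom.mk' (fun φ => QuotientAddGroup.lift _
        ((Cohomology.mk K R n).comp (cocycleCup h φ))
        (fun ψ hψ => (QuotientAddGroup.eq_zero_iff _).2
          (cup_mem_coboundaries_right h φ.2 hψ)))
      (fun φ φ' => by
        refine AddMonoidHom.ext fun y => ?_
        obtain ⟨ψ, rfl⟩ := QuotientAddGroup.mk_surjective y
        change Cohomology.mk K R n (cocycleCup h (φ + φ') ψ) =
          Cohomology.mk K R n (cocycleCup h φ ψ) + Cohomology.mk K R n (cocycleCup h φ' ψ)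
        rw [map_add, AddMonoidHom.add_apply, map_add]))
    (fun φ hφ => by
      refine AddMonoidHom.ext fun y => ?_
      obtain ⟨ψ, rfl⟩ := QuotientAddGroup.mk_surjective y
      exact (QuotientAddGroup.eq_zero_iff _).2 (cup_mem_coboundaries_left h hφ ψ.2))

lemma Cohomology.mk_surjective (n : ℕ) : Function.Surjective (Cohomology.mk K R n) :=
  QuotientAddGroup.mk_surjective

lemma Cohomology.cup_mk {p q n : ℕ} (h : p + q = n) (φ : cocycles K R p) (ψ : cocycles K R q) :
    Cohomology.cup h (Cohomology.mk K R p φ) (Cohomology.mk K R q ψ) =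
      Cohomology.mk K R n (cocycleCup h φ ψ) := rfl

/-- The constant `0`-cochain `1`. -/
def oneCocycle : cocycles K R 0 :=
  ⟨fun _ => 1, by
    change d K R 0 _ = 0
    ext x
    simp [d, Fin.sum_univ_two]⟩

lemma gradedMk_eq {m n : ℕ} (h : m = n) (a : cocycles K R m) (b : cocycles K R n)
    (hab : ∀ x, a.1 (seg K 0 (by omega) x) = b.1 x) :
    GradedMonoid.mk (A := Cohomology K R) m (Cohomology.mk K R m a) =
      GradedMonoid.mk n (Cohomology.mk K R n b) := by
  subst h
  congr 2
  ext x
  rw [← hab, seg_zero_self]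

instance : GradedMonoid.GOne (Cohomology K R) where
  one := Cohomology.mk K R 0 oneCocycle

instance : GradedMonoid.GMul (Cohomology K R) where
  mul := fun a b => Cohomology.cup rfl a b

/-- The cohomology ring structure given by the cup product. -/
instance : DirectSum.GRing (Cohomology K R) where
  mul_zero := fun a => map_zero _
  zero_mul := fun b => by
    change Cohomology.cup rfl 0 b = 0
    simp
  mul_add := fun a b c => map_add _ _ _
  add_mul := fun a b c => by
    change Cohomology.cup rfl (a + b) c = Cohomology.cup rfl a c + Cohomology.cup rfl b c
    simp
  one_mul := by
    rintro ⟨n, a⟩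
    obtain ⟨a, rfl⟩ := Cohomology.mk_surjective n a
    refine gradedMk_eq (zero_add n) (cocycleCup rfl oneCocycle a) a fun x => ?_
    change 1 * a.1 _ = _
    rw [one_mul, seg_seg, seg_zero_self]
  mul_one := by
    rintro ⟨n, a⟩
    obtain ⟨a, rfl⟩ := Cohomology.mk_surjective n a
    refine gradedMk_eq (add_zero n) (cocycleCup rfl a oneCocycle) a fun x => ?_
    change a.1 _ * 1 = _
    rw [mul_one, seg_seg, seg_zero_self]
  mul_assoc := by
    rintro ⟨i, a⟩ ⟨j, b⟩ ⟨k, c⟩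
    obtain ⟨a, rfl⟩ := Cohomology.mk_surjective i a
    obtain ⟨b, rfl⟩ := Cohomology.mk_surjective j b
    obtain ⟨c, rfl⟩ := Cohomology.mk_surjective k c
    refine gradedMk_eq (add_assoc i j k) (cocycleCup rfl (cocycleCup rfl a b) c)
      (cocycleCup rfl a (cocycleCup rfl b c)) fun x => ?_
    change a.1 _ * b.1 _ * c.1 _ = a.1 _ * (b.1 _ * c.1 _)
    simp only [seg_seg, mul_assoc, add_zero, zero_add]
  natCast := fun n => n • Cohomology.mk K R 0 oneCocycle
  natCast_zero := zero_smul _ _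
  natCast_succ := fun n => succ_nsmul _ _
  intCast := fun z => z • Cohomology.mk K R 0 oneCocycle
  intCast_ofNat := fun n => natCast_zsmul _ _
  intCast_negSucc_ofNat := fun n => negSucc_zsmul _ _

variable (R)

/-- The pullback of cochains along a simplicial map. -/
def cochainMap {K L : SSet.{u}} (f : K ⟶ L) (n : ℕ) : Cochain L R n →+ Cochain K R n where
  toFun φ x := φ (f.app _ x)
  map_zero' := rfl
  map_add' _ _ := rfl

lemma d_cochainMap {K L : SSet.{u}} (f : K ⟶ L) (n : ℕ) (φ : Cochain L R n) :
    d K R n (cochainMap R f n φ) = cochainMap R f (n + 1) (d L R n φ) := by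
  ext x
  simp only [d, cochainMap, AddMonoidHom.coe_mk, ZeroHom.coe_mk, SimplicialObject.δ_def]
  refine Finset.sum_congr rfl fun i _ => ?_
  rw [NatTrans.naturality_apply]

/-- The homomorphism `f* : Hⁿ(L; R) → Hⁿ(K; R)` induced by a simplicial map `f : K → L`. -/
def Cohomology.map {K L : SSet.{u}} (f : K ⟶ L) (n : ℕ) : Cohomology L R n →+ Cohomology K R n :=
  QuotientAddGroup.map _ _
    (((cochainMap R f n).comp (cocycles L R n).subtype).codRestrict (cocycles K R n) (by
      rintro ⟨φ, hφ⟩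
      have hφ' : d L R n φ = 0 := hφ
      change d K R n (cochainMap R f n φ) = 0
      rw [d_cochainMap, hφ', map_zero]))
    (by
      rintro ⟨φ, hφ⟩ hb
      change φ ∈ coboundaries L R n at hb
      change cochainMap R f n φ ∈ coboundaries K R n
      cases n with
      | zero =>
        have : φ = 0 := hb
        rw [this, map_zero]
        exact zero_mem _
      | succ n =>
        obtain ⟨θ, rfl⟩ := hb
        exact ⟨cochainMap R f n θ, d_cochainMap R f n θ⟩)

end SimplicialCohomology

/-! ### Singular cohomology -/

/-- The singular cohomology group `Hⁿ(X; R)`. -/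
abbrev SingularCohomology (X : Type u) [TopologicalSpace X] (R : Type v) [Ring R] (n : ℕ) :
    Type (max u v) :=
  SimplicialCohomology.Cohomology (TopCat.toSSet.obj (TopCat.of X)) R n

/-- The singular cohomology ring `H*(X; R) = ⨁ₙ Hⁿ(X; R)`; its multiplication is the cup product. -/
abbrev SingularCohomologyRing (X : Type u) [TopologicalSpace X] (R : Type v) [Ring R] :
    Type (max u v) :=
  DirectSum ℕ (SimplicialCohomology.Cohomology (TopCat.toSSet.obj (TopCat.of X)) R)

/-- The homomorphism `f* : H*(Y; R) → H*(X; R)` induced by a continuous map `f : X → Y`. -/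
def SingularCohomologyRing.map {X Y : Type u} [TopologicalSpace X] [TopologicalSpace Y]
    (R : Type v) [Ring R] (f : C(X, Y)) :
    SingularCohomologyRing Y R →+ SingularCohomologyRing X R :=
  DirectSum.map fun n =>
    SimplicialCohomology.Cohomology.map R (TopCat.toSSet.map (TopCat.ofHom f)) n

/-- The cup length of a subset `S` of a ring: the supremum of the numbers `k` for which some
product of `k` elements of `S` is nonzero. -/
def cupLength {A : Type u} [Ring A] (S : Set A) : ℕ∞ :=
  sSup {m : ℕ∞ | ∃ (k : ℕ) (a : Fin k → A), (∀ i, a i ∈ S) ∧ (List.ofFn a).prod ≠ 0 ∧ m = k}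

/-! ### Parametrised topological complexity -/

/-- A Hurewicz fibration: a continuous map with the homotopy lifting property for all spaces.
(Test spaces in `Type (max u v)` suffice: this universe contains the universal one, the space of
pairs of a point `e` of `E` and a path in `B` starting at `p e`.) -/
structure IsHurewiczFibration {E : Type u} {B : Type v} [TopologicalSpace E] [TopologicalSpace B]
    (p : E → B) : Prop where
  continuous : Continuous p
  homotopyLifting : ∀ (A : Type (max u v)) [TopologicalSpace A] (f : C(A, E))
    (H : C(A × unitInterval, B)), (∀ a, H (a, 0) = p (f a)) →
      ∃ G : C(A × unitInterval, E), (∀ a, G (a, 0) = f a) ∧ ∀ z, p (G z) = H z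

/-- The sectional category of a map `p : E → B`: the smallest `k` such that `B` is covered by
`k + 1` open sets over each of which `p` has a continuous section (`⊤` if there is none). -/
def secat {E : Type u} {B : Type v} [TopologicalSpace E] [TopologicalSpace B] (p : E → B) : ℕ∞ :=
  sInf {m : ℕ∞ | ∃ (k : ℕ) (U : Fin (k + 1) → Set B), (∀ i, IsOpen (U i)) ∧ (⋃ i, U i) = Set.univ ∧
    (∀ i, ∃ s : C(U i, E), ∀ b : U i, p (s b) = b) ∧ m = k}

/-- The space of continuous paths in `E` lying in a single fibre of `p`, with the compact-open
topology. -/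
abbrev FibrePath {E : Type u} {B : Type v} [TopologicalSpace E] (p : E → B) : Type u :=
  {γ : C(unitInterval, E) // ∀ s t, p (γ s) = p (γ t)}

/-- The endpoint map `Π : γ ↦ (γ 0, γ 1)` from fibrewise paths to the fibre product of `E` with
itself over `B`. -/
def endpoints {E : Type u} {B : Type v} [TopologicalSpace E] (p : E → B) (γ : FibrePath p) :
    Function.Pullback p p :=
  ⟨(γ.1 0, γ.1 1), γ.2 0 1⟩

/-- The parametrised topological complexity of `p : E → B`. -/
def parametrisedTC {E : Type u} {B : Type v} [TopologicalSpace E] (p : E → B) : ℕ∞ :=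
  secat (endpoints p)

/-- The diagonal map of `E` into its fibre product with itself over `B`, `e ↦ (e, e)`. -/
def fibreDiagonal {E : Type u} {B : Type v} [TopologicalSpace E] (p : E → B) :
    C(E, Function.Pullback p p) where
  toFun e := ⟨(e, e), rfl⟩
  continuous_toFun := by fun_prop

end

/-! ### Integral chains of simplicial sets and homotopy invariance of cohomology. -/

noncomputable section

namespace SimplicialCohomology

open CategoryTheory Opposite Simplicial

/-! Suppose the fibre product is covered by open sets `U_0, …, U_l` carrying sections of the
endpoint map, with `l < k`. A section `s` over `U_j` gives the homotopy `(x, t) ↦ (s x 0, s x t)`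
from a map through the diagonal to the inclusion of `U_j`. By homotopy invariance
(`Cohomology.map_eq_of_homotopy`) every class in the kernel of `Δ*` restricts to zero on `U_j`
(`map_singularInclusion_eq_zero`). It remains to show that a product of `k` classes vanishes when
the `i`-th one dies on the `i`-th member of an open cover (`prod_eq_zero_of_cover`).

The classical proof multiplies relative classes; here these are replaced by explicit cocycles. A
class that dies on `U_i` has a representative that is zero on all singular simplices in `U_i`:
extend a primitive by zero and subtract its coboundary (`mem_vanishingClasses_range`). Faces of a
simplex in `U_i` lie in `U_i`, so the cup product of the representatives is zero on every simplex
lying in some `U_i` (`cup_mem_vanishingClasses`). A cocycle that is zero on these small simplices is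
a coboundary (`mem_coboundaries_of_eq_zero_on_smallSimplices`).

The last point is the theorem on small chains. Iterated barycentric subdivision makes any chain
small, and it is homotopic to the identity through a homotopy preserving smallness. Subdivision is
built on tuples of points of a simplex, where coning is purely combinatorial, and carried to a space
along affine simplices. Chains are integral and cochains are additive maps on them, so no
commutativity of `R` is needed. -/

/-- Integral simplicial `n`-chains. -/
abbrev Chain (K : SSet.{u}) (n : ℕ) : Type u := K _⦋n⦌ →₀ ℤ

/-- The boundary `∂x = ∑ᵢ (-1)ⁱ ∂ᵢ x`. -/
def boundary (K : SSet.{u}) (n : ℕ) : Chain K (n + 1) →ₗ[ℤ] Chain K n :=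
  ∑ i : Fin (n + 2), (-1 : ℤ) ^ (i : ℕ) • Finsupp.lmapDomain ℤ ℤ (K.δ i)

lemma boundary_single (K : SSet.{u}) (n : ℕ) (x : K _⦋n + 1⦌) :
    boundary K n (Finsupp.single x 1) =
      ∑ i : Fin (n + 2), (-1 : ℤ) ^ (i : ℕ) • Finsupp.single (K.δ i x) 1 := by
  simp [boundary, LinearMap.sum_apply]

lemma chain_hom_ext {K : SSet.{u}} {n : ℕ} {M : Type*} [AddCommGroup M]
    {f g : Chain K n →ₗ[ℤ] M} (h : ∀ x, f (Finsupp.single x 1) = g (Finsupp.single x 1)) :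
    f = g :=
  Finsupp.lhom_ext' fun x => LinearMap.ext_ring (h x)

/-- The free abelian group functor, in an arbitrary universe. -/
def freeFunctor : Type u ⥤ ModuleCat.{u} ℤ where
  obj S := ModuleCat.of ℤ (S →₀ ℤ)
  map f := ModuleCat.ofHom (Finsupp.lmapDomain ℤ ℤ f)
  map_id S := by
    ext1
    exact Finsupp.lmapDomain_id ℤ ℤ
  map_comp f g := by
    ext1
    exact Finsupp.lmapDomain_comp ℤ ℤ f g

/-- The simplicial abelian group of integral chains. -/
abbrev freeSimplicial (K : SSet.{u}) : SimplicialObject (ModuleCat.{u} ℤ) :=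
  ((SimplicialObject.whiskering _ _).obj freeFunctor).obj K

lemma objD_freeSimplicial (K : SSet.{u}) (n : ℕ) :
    (AlgebraicTopology.AlternatingFaceMapComplex.objD (freeSimplicial K) n) =
      ModuleCat.ofHom (boundary K n) := by
  ext1
  rw [AlgebraicTopology.AlternatingFaceMapComplex.objD, ModuleCat.hom_sum]
  rfl

lemma boundary_boundary (K : SSet.{u}) (n : ℕ) (c : Chain K (n + 2)) :
    boundary K n (boundary K (n + 1) c) = 0 := by
  have := AlgebraicTopology.AlternatingFaceMapComplex.d_squared (freeSimplicial K) n
  rw [objD_freeSimplicial, objD_freeSimplicial] at this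
  exact LinearMap.congr_fun (congrArg (fun f => f.hom) this) c

/-- The map of chains induced by a simplicial map. -/
def chainMap {K L : SSet.{u}} (f : K ⟶ L) (n : ℕ) : Chain K n →ₗ[ℤ] Chain L n :=
  Finsupp.lmapDomain ℤ ℤ (f.app (op ⦋n⦌))

@[simp]
lemma chainMap_single {K L : SSet.{u}} (f : K ⟶ L) (n : ℕ) (x : K _⦋n⦌) (r : ℤ) :
    chainMap f n (Finsupp.single x r) = Finsupp.single (f.app _ x) r := by
  simp [chainMap]

lemma chainMap_comp {K L M : SSet.{u}} (f : K ⟶ L) (g : L ⟶ M) (n : ℕ) (c : Chain K n) :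
    chainMap (f ≫ g) n c = chainMap g n (chainMap f n c) := by
  refine DFunLike.congr_fun (f := chainMap (f ≫ g) n)
    (g := chainMap g n ∘ₗ chainMap f n) (chain_hom_ext fun x => ?_) c
  simp

lemma boundary_chainMap {K L : SSet.{u}} (f : K ⟶ L) (n : ℕ) (c : Chain K (n + 1)) :
    boundary L n (chainMap f (n + 1) c) = chainMap f n (boundary K n c) := by
  refine DFunLike.congr_fun (f := boundary L n ∘ₗ chainMap f (n + 1))
    (g := chainMap f n ∘ₗ boundary K n) (chain_hom_ext fun x => ?_) c
  simp only [LinearMap.comp_apply, chainMap_single, boundary_single, map_sum, map_smul]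
  refine Finset.sum_congr rfl fun i _ => ?_
  simp only [SimplicialObject.δ_def]
  rw [NatTrans.naturality_apply]

/-- The evaluation of a cochain on chains. -/
def pairing {K : SSet.{u}} {R : Type v} [Ring R] {n : ℕ} (φ : Cochain K R n) :
    Chain K n →ₗ[ℤ] R :=
  Finsupp.linearCombination ℤ φ

@[simp]
lemma pairing_single {K : SSet.{u}} {R : Type v} [Ring R] {n : ℕ} (φ : Cochain K R n)
    (x : K _⦋n⦌) : pairing φ (Finsupp.single x 1) = φ x := by
  simp [pairing]

lemma d_apply {K : SSet.{u}} {R : Type v} [Ring R] {n : ℕ} (φ : Cochain K R n)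
    (x : K _⦋n + 1⦌) : d K R n φ x = ∑ i : Fin (n + 2), (-1 : R) ^ (i : ℕ) * φ (K.δ i x) := rfl

/-- The coboundary is the transpose of the boundary, so identities between chains can be evaluated
on cochains with values in any ring. -/
lemma pairing_d {K : SSet.{u}} {R : Type v} [Ring R] {n : ℕ} (φ : Cochain K R n)
    (c : Chain K (n + 1)) : pairing (d K R n φ) c = pairing φ (boundary K n c) := by
  refine DFunLike.congr_fun (f := pairing (d K R n φ))
    (g := pairing φ ∘ₗ boundary K n) (chain_hom_ext fun x => ?_) c
  simp only [LinearMap.comp_apply, boundary_single, map_sum, map_smul, pairing_single]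
  rw [d_apply]
  refine Finset.sum_congr rfl fun i _ => ?_
  simp [zsmul_eq_mul]

lemma pairing_eq_zero_of_mem_supported {K : SSet.{u}} {R : Type v} [Ring R] {n : ℕ}
    {φ : Cochain K R n} {s : Set (K _⦋n⦌)} (hφ : ∀ x ∈ s, φ x = 0) {c : Chain K n}
    (hc : c ∈ Finsupp.supported ℤ ℤ s) : pairing φ c = 0 := by
  simp only [pairing, Finsupp.linearCombination_apply, Finsupp.sum]
  refine Finset.sum_eq_zero fun x hx => ?_
  rw [hφ x (hc hx), smul_zero]

/-- Simplicially homotopic maps induce chain homotopic maps of integral chains. -/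
lemma exists_chain_homotopy {K L : SSet.{u}} {f g : K ⟶ L} (H : SSet.Homotopy f g) :
    ∃ h : ∀ n, Chain K n →ₗ[ℤ] Chain L (n + 1),
      (∀ c, chainMap f 0 c = boundary L 0 (h 0 c) + chainMap g 0 c) ∧
      ∀ n c, chainMap f (n + 1) c =
        h n (boundary K n c) + boundary L (n + 1) (h (n + 1) c) + chainMap g (n + 1) c := by
  -- The free abelian group functor turns the simplicial homotopy into one of simplicial modules,
  -- and this yields a homotopy of alternating face map complexes. Its relation has no `h ∂` term in
  -- degree `0`.
  let H' := (H.toSimplicialObjectHomotopy.whiskerRight freeFunctor).toChainHomotopy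
  refine ⟨fun n => (H'.hom n (n + 1)).hom, fun c => ?_, fun n c => ?_⟩
  · have := H'.comm 0
    rw [prevD_eq (j' := 1) (w := by simp), dNext_eq_zero _ _ (by simp), zero_add,
      AlgebraicTopology.alternatingFaceMapComplex_obj_d, objD_freeSimplicial] at this
    exact LinearMap.congr_fun (congrArg (fun f => f.hom) this) c
  · have := H'.comm (n + 1)
    rw [dNext_eq (i' := n) (w := by simp), prevD_eq (j' := n + 2) (w := by simp),
      AlgebraicTopology.alternatingFaceMapComplex_obj_d,
      AlgebraicTopology.alternatingFaceMapComplex_obj_d, objD_freeSimplicial,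
      objD_freeSimplicial] at this
    exact LinearMap.congr_fun (congrArg (fun f => f.hom) this) c

lemma Cohomology.map_mk {K L : SSet.{u}} {R : Type v} [Ring R] (f : K ⟶ L) (n : ℕ)
    (φ : cocycles L R n) (hφ : cochainMap R f n φ.1 ∈ cocycles K R n) :
    Cohomology.map R f n (Cohomology.mk L R n φ) = Cohomology.mk K R n ⟨_, hφ⟩ := rfl

lemma cochainMap_mem_cocycles {K L : SSet.{u}} {R : Type v} [Ring R] (f : K ⟶ L) {n : ℕ}
    {φ : Cochain L R n} (hφ : φ ∈ cocycles L R n) : cochainMap R f n φ ∈ cocycles K R n := by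
  have hφ' : d L R n φ = 0 := hφ
  change d K R n (cochainMap R f n φ) = 0
  rw [d_cochainMap, hφ', map_zero]

lemma Cohomology.mk_eq_zero_iff {K : SSet.{u}} {R : Type v} [Ring R] {n : ℕ}
    (φ : cocycles K R n) : Cohomology.mk K R n φ = 0 ↔ φ.1 ∈ coboundaries K R n :=
  QuotientAddGroup.eq_zero_iff _

lemma Cohomology.map_comp {K L M : SSet.{u}} {R : Type v} [Ring R] (f : K ⟶ L) (g : L ⟶ M) (n : ℕ)
    (a : Cohomology M R n) :
    Cohomology.map R (f ≫ g) n a = Cohomology.map R f n (Cohomology.map R g n a) := by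
  obtain ⟨φ, rfl⟩ := Cohomology.mk_surjective n a
  rfl

lemma pairing_cochainMap {K L : SSet.{u}} {R : Type v} [Ring R] (f : K ⟶ L) {n : ℕ}
    (φ : Cochain L R n) (c : Chain K n) :
    pairing (cochainMap R f n φ) c = pairing φ (chainMap f n c) := by
  refine DFunLike.congr_fun (f := pairing (cochainMap R f n φ))
    (g := pairing φ ∘ₗ chainMap f n) (chain_hom_ext fun x => ?_) c
  simp [cochainMap]

/-- Homotopy invariance of simplicial cohomology. -/
lemma Cohomology.map_eq_of_homotopy {K L : SSet.{u}} {R : Type v} [Ring R] {f g : K ⟶ L}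
    (H : SSet.Homotopy f g) (n : ℕ) : Cohomology.map R f n = Cohomology.map R g n := by
  obtain ⟨h, h0, h1⟩ := exists_chain_homotopy H
  ext a
  obtain ⟨⟨φ, hφ⟩, rfl⟩ := Cohomology.mk_surjective n a
  have hd : d L R n φ = 0 := hφ
  rw [map_mk _ _ _ (cochainMap_mem_cocycles f hφ), map_mk _ _ _ (cochainMap_mem_cocycles g hφ),
    ← sub_eq_zero, ← map_sub, mk_eq_zero_iff]
  -- A cocycle kills boundaries, so the `∂ h` term disappears; the `h ∂` term becomes the coboundary
  -- of `φ ∘ h`.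
  have hb (c : Chain L (n + 1)) : pairing φ (boundary L n c) = 0 := by
    rw [← pairing_d, hd]
    exact pairing_eq_zero_of_mem_supported (s := Set.univ) (by simp) (by simp)
  cases n with
  | zero =>
    change cochainMap R f 0 φ - cochainMap R g 0 φ = 0
    ext x
    have := congrArg (pairing φ) (h0 (Finsupp.single x 1))
    rw [map_add, hb, zero_add, ← pairing_cochainMap, ← pairing_cochainMap, pairing_single,
      pairing_single] at this
    simp [this]
  | succ n =>
    refine ⟨fun x => pairing φ (h n (Finsupp.single x 1)), ?_⟩
    ext x
    have := congrArg (pairing φ) (h1 n (Finsupp.single x 1))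
    rw [map_add, map_add, hb, add_zero, ← pairing_cochainMap, ← pairing_cochainMap, pairing_single,
      pairing_single] at this
    have e : pairing (fun x => pairing φ (h n (Finsupp.single x 1))) = pairing φ ∘ₗ h n :=
      chain_hom_ext fun x => by simp
    rw [← pairing_single (d K R n _) x, pairing_d, e, LinearMap.comp_apply]
    simp [this]

end SimplicialCohomology

end

/-! ### Cones and subdivision in codiscrete simplicial sets. -/

noncomputable section

namespace SimplicialCohomology

open CategoryTheory Opposite

section Chains

open scoped Simplicial

/-- The codiscrete simplicial set on `Y`: its `n`-simplices are the `(n + 1)`-tuples in `Y`. -/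
def tuples (Y : Type u) : SSet.{u} where
  obj n := Fin (n.unop.len + 1) → Y
  map f := ↾(fun v => v ∘ f.unop.toOrderHom)

/-- The map of codiscrete simplicial sets induced by a map of sets. -/
def tuplesMap {Y Z : Type u} (g : Y → Z) : tuples Y ⟶ tuples Z where
  app n := ↾(fun v => g ∘ v)

/-- Prepend a vertex to a simplex of `tuples Y`. -/
def tuplesCons {Y : Type u} {n : ℕ} (y : Y) (v : (tuples Y) _⦋n⦌) : (tuples Y) _⦋n + 1⦌ :=
  (Fin.cons y (v : Fin (n + 1) → Y) : Fin (n + 2) → Y)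

lemma tuples_δ {Y : Type u} {n : ℕ} (i : Fin (n + 2)) (v : (tuples Y) _⦋n + 1⦌)
    (j : Fin (n + 1)) : (tuples Y).δ i v j = v (i.succAbove j) := rfl

lemma tuples_δ_zero_cons {Y : Type u} {n : ℕ} (y : Y) (v : (tuples Y) _⦋n⦌) :
    (tuples Y).δ 0 (tuplesCons y v) = v := by
  refine funext fun (j : Fin (n + 1)) => ?_
  rw [tuples_δ, Fin.zero_succAbove]
  rfl

lemma tuples_δ_succ_cons {Y : Type u} {n : ℕ} (y : Y) (v : (tuples Y) _⦋n + 1⦌)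
    (i : Fin (n + 2)) :
    (tuples Y).δ i.succ (tuplesCons y v) = tuplesCons y ((tuples Y).δ i v) := by
  refine funext fun (j : Fin (n + 2)) => ?_
  rw [tuples_δ]
  refine Fin.cases ?_ (fun j => ?_) j
  · rw [Fin.succ_succAbove_zero]
    rfl
  · rw [Fin.succ_succAbove_succ]
    rfl

lemma tuples_δ_one_cons {Y : Type u} (y : Y) (v : (tuples Y) _⦋0⦌) :
    (tuples Y).δ 1 (tuplesCons y v) = (fun _ => y : Fin 1 → Y) := by
  refine funext fun (j : Fin 1) => ?_
  rw [tuples_δ, Subsingleton.elim j 0]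
  rfl

/-- The cone with apex `y` on a chain. -/
def cone {Y : Type u} (y : Y) (n : ℕ) : Chain (tuples Y) n →ₗ[ℤ] Chain (tuples Y) (n + 1) :=
  Finsupp.lmapDomain ℤ ℤ (tuplesCons y)

@[simp]
lemma cone_single {Y : Type u} (y : Y) (n : ℕ) (v : (tuples Y) _⦋n⦌) (r : ℤ) :
    cone y n (Finsupp.single v r) = Finsupp.single (tuplesCons y v) r := by
  simp [cone]

/-- The zeroth face deletes the apex; the other faces are cones over faces of the base, with the
sign shifted by one. -/
lemma boundary_cone {Y : Type u} (y : Y) (n : ℕ) (c : Chain (tuples Y) (n + 1)) :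
    boundary _ (n + 1) (cone y (n + 1) c) = c - cone y n (boundary _ n c) := by
  refine DFunLike.congr_fun (f := boundary _ (n + 1) ∘ₗ cone y (n + 1))
    (g := LinearMap.id - cone y n ∘ₗ boundary _ n) (chain_hom_ext fun v => ?_) c
  simp only [LinearMap.comp_apply, LinearMap.sub_apply, cone_single, boundary_single,
    LinearMap.id_apply, map_sum, map_smul]
  rw [Fin.sum_univ_succ, tuples_δ_zero_cons, sub_eq_add_neg, ← Finset.sum_neg_distrib]
  simp [tuples_δ_succ_cons, pow_succ]

/-- The lowest-degree substitute for `boundary_cone`. Coning a `0`-chain leaves an extra multiple of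
the apex, given by the sum of the coefficients, and this sum is zero for a boundary. -/
lemma boundary_cone_boundary {Y : Type u} (y : Y) (c : Chain (tuples Y) 1) :
    boundary _ 0 (cone y 0 (boundary _ 0 c)) = boundary _ 0 c := by
  refine DFunLike.congr_fun (f := boundary _ 0 ∘ₗ cone y 0 ∘ₗ boundary _ 0)
    (g := boundary _ 0) (chain_hom_ext fun v => ?_) c
  simp [boundary_single, Fin.sum_univ_two, tuples_δ_zero_cons, tuples_δ_one_cons]

lemma chainMap_cone {Y Z : Type u} (g : Y → Z) (y : Y) (n : ℕ) (c : Chain (tuples Y) n) :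
    chainMap (tuplesMap g) (n + 1) (cone y n c) = cone (g y) n (chainMap (tuplesMap g) n c) := by
  refine DFunLike.congr_fun (f := chainMap (tuplesMap g) (n + 1) ∘ₗ cone y n)
    (g := cone (g y) n ∘ₗ chainMap (tuplesMap g) n) (chain_hom_ext fun v => ?_) c
  simp only [LinearMap.comp_apply, cone_single, chainMap_single]
  congr 1
  refine funext fun (j : Fin (n + 2)) => ?_
  refine Fin.cases ?_ (fun j => ?_) j <;> rfl

/-- A choice of a cone point for each simplex of `tuples Y`. -/
abbrev Apex (Y : Type u) : Type u := ∀ n : ℕ, (tuples Y) _⦋n⦌ → Y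

end Chains

section

variable {Y : Type u} (b : Apex Y)

/-- Subdivision of chains, obtained by coning off with the apices `b`. -/
def tuplesSd : ∀ n : ℕ, Chain (tuples Y) n →ₗ[ℤ] Chain (tuples Y) n
  | 0 => LinearMap.id
  | n + 1 => Finsupp.linearCombination ℤ fun v =>
      cone (b (n + 1) v) n (tuplesSd n (boundary _ n (Finsupp.single v 1)))

/-- The chain homotopy from the subdivision to the identity. -/
def tuplesSdHomotopy : ∀ n : ℕ, Chain (tuples Y) n →ₗ[ℤ] Chain (tuples Y) (n + 1)
  | 0 => 0
  | n + 1 => Finsupp.linearCombination ℤ fun v =>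
      cone (b (n + 1) v) (n + 1)
        (Finsupp.single v 1 - tuplesSdHomotopy n (boundary _ n (Finsupp.single v 1)))

end

section Subdivision

open scoped Simplicial

variable {Y : Type u} (b : Apex Y)

@[simp]
lemma tuplesSd_zero (c : Chain (tuples Y) 0) : tuplesSd b 0 c = c := rfl

lemma tuplesSd_succ_single (n : ℕ) (v : (tuples Y) _⦋n + 1⦌) :
    tuplesSd b (n + 1) (Finsupp.single v 1) =
      cone (b (n + 1) v) n (tuplesSd b n (boundary _ n (Finsupp.single v 1))) := by
  simp [tuplesSd]

@[simp]
lemma tuplesSdHomotopy_zero (c : Chain (tuples Y) 0) : tuplesSdHomotopy b 0 c = 0 := rfl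

lemma tuplesSdHomotopy_succ_single (n : ℕ) (v : (tuples Y) _⦋n + 1⦌) :
    tuplesSdHomotopy b (n + 1) (Finsupp.single v 1) = cone (b (n + 1) v) (n + 1)
      (Finsupp.single v 1 - tuplesSdHomotopy b n (boundary _ n (Finsupp.single v 1))) := by
  simp [tuplesSdHomotopy]

/-- The cone formula gives `∂ Sd v = Sd ∂v - cone (∂ Sd ∂v)`, and the last term is zero by induction
and `∂∂ = 0`. -/
lemma boundary_tuplesSd (n : ℕ) (c : Chain (tuples Y) (n + 1)) :
    boundary _ n (tuplesSd b (n + 1) c) = tuplesSd b n (boundary _ n c) := by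
  induction n with
  | zero =>
    refine DFunLike.congr_fun (f := boundary _ 0 ∘ₗ tuplesSd b 1)
      (g := tuplesSd b 0 ∘ₗ boundary _ 0) (chain_hom_ext fun v => ?_) c
    simp only [LinearMap.comp_apply, tuplesSd_succ_single, tuplesSd_zero, boundary_cone_boundary]
  | succ n ih =>
    refine DFunLike.congr_fun (f := boundary _ (n + 1) ∘ₗ tuplesSd b (n + 2))
      (g := tuplesSd b (n + 1) ∘ₗ boundary _ (n + 1)) (chain_hom_ext fun v => ?_) c
    simp only [LinearMap.comp_apply, tuplesSd_succ_single b (n + 1), boundary_cone, ih,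
      boundary_boundary, map_zero, sub_zero]

lemma boundary_tuplesSdHomotopy (n : ℕ) (c : Chain (tuples Y) (n + 1)) :
    boundary _ (n + 1) (tuplesSdHomotopy b (n + 1) c) =
      c - tuplesSd b (n + 1) c - tuplesSdHomotopy b n (boundary _ n c) := by
  induction n with
  | zero =>
    refine DFunLike.congr_fun (f := boundary _ 1 ∘ₗ tuplesSdHomotopy b 1)
      (g := LinearMap.id - tuplesSd b 1 - tuplesSdHomotopy b 0 ∘ₗ boundary _ 0)
      (chain_hom_ext fun v => ?_) c
    simp only [LinearMap.comp_apply, LinearMap.sub_apply, LinearMap.id_apply,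
      tuplesSdHomotopy_succ_single b 0, tuplesSdHomotopy_zero, sub_zero, boundary_cone,
      tuplesSd_succ_single, tuplesSd_zero]
  | succ n ih =>
    refine DFunLike.congr_fun (f := boundary _ (n + 2) ∘ₗ tuplesSdHomotopy b (n + 2))
      (g := LinearMap.id - tuplesSd b (n + 2) - tuplesSdHomotopy b (n + 1) ∘ₗ boundary _ (n + 1))
      (chain_hom_ext fun v => ?_) c
    simp only [LinearMap.comp_apply, LinearMap.sub_apply, LinearMap.id_apply,
      tuplesSdHomotopy_succ_single b (n + 1), boundary_cone, tuplesSd_succ_single, map_sub, ih,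
      boundary_boundary, map_zero, sub_zero]
    abel

variable {Z : Type u} (b' : Apex Z) {b}

/-- Subdivision is determined by the choice of apices, hence natural for maps that respect this
choice. Affine maps respect barycentres, which is the case needed. -/
lemma chainMap_tuplesSd (g : Y → Z)
    (hg : ∀ n (v : (tuples Y) _⦋n⦌), g (b n v) = b' n ((tuplesMap g).app _ v)) (n : ℕ)
    (c : Chain (tuples Y) n) :
    chainMap (tuplesMap g) n (tuplesSd b n c) = tuplesSd b' n (chainMap (tuplesMap g) n c) := by
  induction n with
  | zero => rfl
  | succ n ih =>
    refine DFunLike.congr_fun (f := chainMap (tuplesMap g) (n + 1) ∘ₗ tuplesSd b (n + 1))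
      (g := tuplesSd b' (n + 1) ∘ₗ chainMap (tuplesMap g) (n + 1)) (chain_hom_ext fun v => ?_) c
    simp only [LinearMap.comp_apply, tuplesSd_succ_single, chainMap_cone, ih, chainMap_single, hg,
      ← boundary_chainMap]

lemma chainMap_tuplesSdHomotopy (g : Y → Z)
    (hg : ∀ n (v : (tuples Y) _⦋n⦌), g (b n v) = b' n ((tuplesMap g).app _ v)) (n : ℕ)
    (c : Chain (tuples Y) n) :
    chainMap (tuplesMap g) (n + 1) (tuplesSdHomotopy b n c) =
      tuplesSdHomotopy b' n (chainMap (tuplesMap g) n c) := by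
  induction n with
  | zero => simp
  | succ n ih =>
    refine DFunLike.congr_fun (f := chainMap (tuplesMap g) (n + 2) ∘ₗ tuplesSdHomotopy b (n + 1))
      (g := tuplesSdHomotopy b' (n + 1) ∘ₗ chainMap (tuplesMap g) (n + 1))
      (chain_hom_ext fun v => ?_) c
    simp only [LinearMap.comp_apply, tuplesSdHomotopy_succ_single, chainMap_cone, ih,
      chainMap_single, hg, ← boundary_chainMap, map_sub]

end Subdivision

end SimplicialCohomology

end

/-! ### Convex combinations in standard simplices and distance estimates. -/

noncomputable section

namespace stdSimplex

variable {ι κ μ : Type*} [Fintype ι] [Fintype κ] [Fintype μ]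

/-- The convex combination with weights `t` of the points `v i` of a standard simplex. -/
def mix (v : ι → stdSimplex ℝ κ) (t : stdSimplex ℝ ι) : stdSimplex ℝ κ :=
  ⟨∑ i, t i • (v i : κ → ℝ), (convex_stdSimplex ℝ κ).sum_mem (fun i _ => t.2.1 i) t.2.2
    fun i _ => (v i).2⟩

lemma coe_mix (v : ι → stdSimplex ℝ κ) (t : stdSimplex ℝ ι) :
    (mix v t : κ → ℝ) = ∑ i, t i • (v i : κ → ℝ) := rfl

lemma mix_apply (v : ι → stdSimplex ℝ κ) (t : stdSimplex ℝ ι) (k : κ) :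
    mix v t k = ∑ i, t i * v i k := by
  change (∑ i, t i • (v i : κ → ℝ)) k = _
  simp

lemma mix_vertex [DecidableEq ι] (v : ι → stdSimplex ℝ κ) (i : ι) :
    mix v (vertex i) = v i := by
  ext k
  change mix v (vertex i) k = v i k
  rw [mix_apply]
  simp [Pi.single_apply]

lemma mix_vertices [DecidableEq ι] (t : stdSimplex ℝ ι) : mix vertex t = t := by
  ext k
  change mix vertex t k = t k
  rw [mix_apply]
  simp [Pi.single_apply]

lemma mix_mix (v : κ → stdSimplex ℝ μ) (w : ι → stdSimplex ℝ κ) (t : stdSimplex ℝ ι) :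
    mix (fun i => mix v (w i)) t = mix v (mix w t) := by
  ext k
  change mix (fun i => mix v (w i)) t k = mix v (mix w t) k
  simp only [mix_apply, Finset.mul_sum, Finset.sum_mul]
  rw [Finset.sum_comm]
  simp only [mul_assoc]

/-- Reindexing the points pushes the weights forward. This is what makes `affineSimplices` natural
in the simplicial operators. -/
lemma mix_comp [DecidableEq κ] (v : κ → stdSimplex ℝ μ) (f : ι → κ) (t : stdSimplex ℝ ι) :
    mix (v ∘ f) t = mix v (map f t) := by
  have h : map f t = mix (fun i => vertex (f i)) t := by
    ext k
    change map f t k = mix (fun i => vertex (f i)) t k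
    rw [mix_apply, map_coe, FunOnFinite.linearMap_apply_apply]
    simp [Pi.single_apply, Finset.sum_filter, eq_comm]
  rw [h, ← mix_mix]
  simp only [mix_vertex]
  rfl

lemma continuous_mix (v : ι → stdSimplex ℝ κ) : Continuous (mix v) := by
  refine Continuous.subtype_mk ?_ _
  refine continuous_finsetSum _ fun i _ => ?_
  refine Continuous.smul (f := fun t : stdSimplex ℝ ι => t i) ?_ continuous_const
  exact (continuous_apply i).comp continuous_subtype_val

lemma norm_sum_smul_le {E : Type*} [SeminormedAddCommGroup E] [NormedSpace ℝ E]
    (t : stdSimplex ℝ ι) {z : ι → E} {r : ℝ} (h : ∀ i, ‖z i‖ ≤ r) : ‖∑ i, t i • z i‖ ≤ r := by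
  have := (convex_closedBall (0 : E) r).sum_mem (t := Finset.univ) (w := t) (z := z)
    (fun i _ => t.2.1 i) t.2.2 (fun i _ => by simpa using h i)
  simpa using this

lemma dist_eq_norm_coe (p q : stdSimplex ℝ ι) : dist p q = ‖(p : ι → ℝ) - q‖ := by
  rw [Subtype.dist_eq, dist_eq_norm]
  rfl

lemma dist_mix_le {v : ι → stdSimplex ℝ κ} {p : stdSimplex ℝ κ} {r : ℝ}
    (h : ∀ i, dist p (v i) ≤ r) (t : stdSimplex ℝ ι) : dist p (mix v t) ≤ r := by
  have e : (p : κ → ℝ) - mix v t = ∑ i, t i • ((p : κ → ℝ) - v i) := by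
    simp only [smul_sub, Finset.sum_sub_distrib, ← Finset.sum_smul, sum_eq_one, one_smul, coe_mix]
  rw [dist_eq_norm_coe, e]
  exact norm_sum_smul_le t fun i => by rw [← dist_eq_norm_coe]; exact h i

/-- The difference is the average of the `n + 1` vectors `v j - v i`. The one with `j = i` is zero,
and the other `n` contribute at most `r / (n + 1)` each. -/
lemma dist_mix_barycenter_le {n : ℕ} {v : Fin (n + 1) → stdSimplex ℝ κ} {r : ℝ}
    (h : ∀ i j, dist (v i) (v j) ≤ r) (i : Fin (n + 1)) :
    dist (mix v barycenter) (v i) ≤ n / (n + 1) * r := by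
  have e : (mix v barycenter : κ → ℝ) - v i =
      ∑ j, (barycenter : stdSimplex ℝ (Fin (n + 1))) j • ((v j : κ → ℝ) - v i) := by
    simp only [smul_sub, Finset.sum_sub_distrib, ← Finset.sum_smul, sum_eq_one, one_smul, coe_mix]
  rw [dist_eq_norm_coe, e, ← Finset.add_sum_erase _ _ (Finset.mem_univ i), sub_self,
    smul_zero, zero_add]
  refine (norm_sum_le _ _).trans ((Finset.sum_le_card_nsmul _ _ ((1 / (n + 1)) * r) ?_).trans ?_)
  · intro j _
    rw [norm_smul]
    have h1 := h j i
    rw [dist_eq_norm_coe] at h1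
    have : ‖(barycenter : stdSimplex ℝ (Fin (n + 1))) j‖ = 1 / (n + 1) := by
      rw [Real.norm_of_nonneg (zero_le _ _)]
      exact (barycenter_apply j).trans (by simp)
    rw [this]
    gcongr
  · rw [Finset.card_erase_of_mem (Finset.mem_univ i)]
    simp
    field_simp
    rfl

end stdSimplex

/-! ### Affine singular simplices and barycentric subdivision of singular chains. -/

namespace SimplicialCohomology

open CategoryTheory Opposite

open scoped Simplicial

/-- The affine map of topological simplices with given values on the vertices. -/
def affineMap {m n : SimplexCategory} (v : (tuples (SimplexCategory.toTop.{u}.obj n)).obj (op m)) :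
    SimplexCategory.toTop.{u}.obj m ⟶ SimplexCategory.toTop.{u}.obj n :=
  TopCat.ofHom
    { toFun := fun t => ULift.up (stdSimplex.mix (fun i => (v i).down) t.down)
      continuous_toFun := continuous_uliftUp.comp
        ((stdSimplex.continuous_mix _).comp continuous_uliftDown) }

/-- Tuples of points of a topological simplex span affine singular simplices. -/
def affineSimplices (n : SimplexCategory) :
    tuples (SimplexCategory.toTop.{u}.obj n) ⟶
      TopCat.toSSet.obj (SimplexCategory.toTop.{u}.obj n) where
  app m := ↾(fun v => ULift.up (affineMap v))
  naturality m m' f := by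
    ext v
    apply ULift.ext
    refine TopCat.hom_ext (ContinuousMap.ext fun t => ?_)
    exact congrArg ULift.up (stdSimplex.mix_comp (fun i => (v i).down) f.unop.toOrderHom t.down)

/-- The barycentres of the affine simplices. -/
def barycentre (n : SimplexCategory) : Apex (SimplexCategory.toTop.{u}.obj n) :=
  fun _ v => affineMap v (ULift.up stdSimplex.barycenter)

/-- The tuple of vertices of the topological `n`-simplex. -/
def vertices (n : ℕ) : (tuples (SimplexCategory.toTop.{u}.obj ⦋n⦌)) _⦋n⦌ :=
  fun i : Fin (n + 1) => ULift.up (stdSimplex.vertex i)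

lemma affineMap_vertices (n : ℕ) : affineMap (vertices.{u} n) = 𝟙 _ := by
  refine TopCat.hom_ext (ContinuousMap.ext fun t => ?_)
  exact congrArg ULift.up (stdSimplex.mix_vertices _)

lemma tuplesMap_affineMap_vertices {m : ℕ} {n : SimplexCategory}
    (v : (tuples (SimplexCategory.toTop.{u}.obj n)) _⦋m⦌) :
    (tuplesMap (affineMap v)).app _ (vertices m) = v :=
  funext fun i => congrArg ULift.up (stdSimplex.mix_vertex _ i)

lemma affineMap_barycentre {m n : SimplexCategory}
    (w : (tuples (SimplexCategory.toTop.{u}.obj n)).obj (op m)) (k : ℕ)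
    (v : (tuples (SimplexCategory.toTop.{u}.obj m)) _⦋k⦌) :
    affineMap w (barycentre m k v) = barycentre n k ((tuplesMap (affineMap w)).app _ v) :=
  congrArg ULift.up (stdSimplex.mix_mix _ _ _).symm

section Singular

variable {X : TopCat.{u}}

/-- The simplicial map from tuples of points of the simplex to singular simplices of `X` defined by
a singular simplex. -/
def affineOf {n : ℕ} (σ : (TopCat.toSSet.obj X) _⦋n⦌) :
    tuples (SimplexCategory.toTop.{u}.obj ⦋n⦌) ⟶ TopCat.toSSet.obj X :=
  affineSimplices ⦋n⦌ ≫ TopCat.toSSet.map σ.down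

lemma affineOf_down {m n : ℕ} (σ : (TopCat.toSSet.obj X) _⦋n⦌)
    (v : (tuples (SimplexCategory.toTop.{u}.obj ⦋n⦌)) _⦋m⦌) :
    ((affineOf σ).app _ v).down = affineMap v ≫ σ.down := rfl

lemma affineOf_vertices {n : ℕ} (σ : (TopCat.toSSet.obj X) _⦋n⦌) :
    (affineOf σ).app _ (vertices n) = σ := by
  apply ULift.ext
  rw [affineOf_down, affineMap_vertices]
  rfl

/-- A convex combination of convex combinations is again one, so an affine simplex inside `σ`
carries the affine structure induced from `σ`. -/
lemma affineOf_affineOf {m n : ℕ} (σ : (TopCat.toSSet.obj X) _⦋n⦌)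
    (w : (tuples (SimplexCategory.toTop.{u}.obj ⦋n⦌)) _⦋m⦌) :
    affineOf ((affineOf σ).app _ w) = tuplesMap (affineMap w) ≫ affineOf σ := by
  ext k v
  apply ULift.ext
  refine TopCat.hom_ext (ContinuousMap.ext fun t => ?_)
  exact congrArg (fun t => (show SimplexCategory.toTop.obj ⦋n⦌ ⟶ X from σ.down) (ULift.up t)) (stdSimplex.mix_mix _ _ _).symm

/-- Barycentric subdivision of singular chains. -/
def singularSd (X : TopCat.{u}) (n : ℕ) :
    Chain (TopCat.toSSet.obj X) n →ₗ[ℤ] Chain (TopCat.toSSet.obj X) n :=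
  Finsupp.linearCombination ℤ fun σ =>
    chainMap (affineOf σ) n (tuplesSd (barycentre ⦋n⦌) n (Finsupp.single (vertices n) 1))

/-- The chain homotopy from barycentric subdivision to the identity. -/
def singularSdHomotopy (X : TopCat.{u}) (n : ℕ) :
    Chain (TopCat.toSSet.obj X) n →ₗ[ℤ] Chain (TopCat.toSSet.obj X) (n + 1) :=
  Finsupp.linearCombination ℤ fun σ =>
    chainMap (affineOf σ) (n + 1)
      (tuplesSdHomotopy (barycentre ⦋n⦌) n (Finsupp.single (vertices n) 1))

lemma singularSd_single {n : ℕ} (σ : (TopCat.toSSet.obj X) _⦋n⦌) :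
    singularSd X n (Finsupp.single σ 1) =
      chainMap (affineOf σ) n (tuplesSd (barycentre ⦋n⦌) n (Finsupp.single (vertices n) 1)) := by
  simp [singularSd]

lemma singularSdHomotopy_single {n : ℕ} (σ : (TopCat.toSSet.obj X) _⦋n⦌) :
    singularSdHomotopy X n (Finsupp.single σ 1) = chainMap (affineOf σ) (n + 1)
      (tuplesSdHomotopy (barycentre ⦋n⦌) n (Finsupp.single (vertices n) 1)) := by
  simp [singularSdHomotopy]

/-- Together with `single_eq_chainMap`, this reduces identities about singular subdivision to the
model simplex, where they are known for tuples. -/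
lemma singularSd_chainMap {m n : ℕ} (σ : (TopCat.toSSet.obj X) _⦋n⦌)
    (c : Chain (tuples (SimplexCategory.toTop.{u}.obj ⦋n⦌)) m) :
    singularSd X m (chainMap (affineOf σ) m c) =
      chainMap (affineOf σ) m (tuplesSd (barycentre ⦋n⦌) m c) := by
  refine DFunLike.congr_fun (f := singularSd X m ∘ₗ chainMap (affineOf σ) m)
    (g := chainMap (affineOf σ) m ∘ₗ tuplesSd (barycentre ⦋n⦌) m) (chain_hom_ext fun w => ?_) c
  rw [LinearMap.comp_apply, LinearMap.comp_apply, chainMap_single, singularSd_single,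
    affineOf_affineOf, chainMap_comp, chainMap_tuplesSd _ _ (affineMap_barycentre w),
    chainMap_single, tuplesMap_affineMap_vertices]

lemma singularSdHomotopy_chainMap {m n : ℕ} (σ : (TopCat.toSSet.obj X) _⦋n⦌)
    (c : Chain (tuples (SimplexCategory.toTop.{u}.obj ⦋n⦌)) m) :
    singularSdHomotopy X m (chainMap (affineOf σ) m c) =
      chainMap (affineOf σ) (m + 1) (tuplesSdHomotopy (barycentre ⦋n⦌) m c) := by
  refine DFunLike.congr_fun (f := singularSdHomotopy X m ∘ₗ chainMap (affineOf σ) m)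
    (g := chainMap (affineOf σ) (m + 1) ∘ₗ tuplesSdHomotopy (barycentre ⦋n⦌) m)
    (chain_hom_ext fun w => ?_) c
  rw [LinearMap.comp_apply, LinearMap.comp_apply, chainMap_single, singularSdHomotopy_single,
    affineOf_affineOf, chainMap_comp, chainMap_tuplesSdHomotopy _ _ (affineMap_barycentre w),
    chainMap_single, tuplesMap_affineMap_vertices]

lemma single_eq_chainMap {n : ℕ} (σ : (TopCat.toSSet.obj X) _⦋n⦌) :
    Finsupp.single σ (1 : ℤ) = chainMap (affineOf σ) n (Finsupp.single (vertices n) 1) := by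
  rw [chainMap_single, affineOf_vertices]

lemma boundary_singularSd (n : ℕ) (c : Chain (TopCat.toSSet.obj X) (n + 1)) :
    boundary _ n (singularSd X (n + 1) c) = singularSd X n (boundary _ n c) := by
  refine DFunLike.congr_fun (f := boundary _ n ∘ₗ singularSd X (n + 1))
    (g := singularSd X n ∘ₗ boundary _ n) (chain_hom_ext fun σ => ?_) c
  rw [LinearMap.comp_apply, LinearMap.comp_apply, single_eq_chainMap, singularSd_chainMap,
    boundary_chainMap, boundary_chainMap, singularSd_chainMap, boundary_tuplesSd]

lemma boundary_singularSdHomotopy (n : ℕ) (c : Chain (TopCat.toSSet.obj X) (n + 1)) :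
    boundary _ (n + 1) (singularSdHomotopy X (n + 1) c) =
      c - singularSd X (n + 1) c - singularSdHomotopy X n (boundary _ n c) := by
  refine DFunLike.congr_fun (f := boundary _ (n + 1) ∘ₗ singularSdHomotopy X (n + 1))
    (g := LinearMap.id - singularSd X (n + 1) - singularSdHomotopy X n ∘ₗ boundary _ n)
    (chain_hom_ext fun σ => ?_) c
  rw [LinearMap.comp_apply, LinearMap.sub_apply, LinearMap.sub_apply, LinearMap.id_apply,
    LinearMap.comp_apply, single_eq_chainMap, singularSdHomotopy_chainMap, singularSd_chainMap,
    boundary_chainMap, boundary_chainMap, singularSdHomotopy_chainMap,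
    boundary_tuplesSdHomotopy, map_sub, map_sub]

end Singular

end SimplicialCohomology

end

/-! ### Mesh of subdivisions and the theorem on small chains. -/

noncomputable section

namespace SimplicialCohomology

open CategoryTheory Opposite

open scoped Simplicial

lemma map_mem_supported {α β : Type*} {f : (α →₀ ℤ) →ₗ[ℤ] (β →₀ ℤ)} {s : Set α} {t : Set β}
    (h : ∀ x ∈ s, f (Finsupp.single x 1) ∈ Finsupp.supported ℤ ℤ t) {c : α →₀ ℤ}
    (hc : c ∈ Finsupp.supported ℤ ℤ s) : f c ∈ Finsupp.supported ℤ ℤ t := by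
  rw [Finsupp.supported_eq_span_single] at hc
  induction hc using Submodule.span_induction with
  | mem x hx =>
    obtain ⟨a, ha, rfl⟩ := hx
    exact h a ha
  | zero => simp
  | add x y _ _ hx hy =>
    rw [map_add]
    exact add_mem hx hy
  | smul a x _ hx =>
    rw [map_smul]
    exact Submodule.smul_mem _ _ hx

lemma chainMap_mem_supported {K L : SSet.{u}} (f : K ⟶ L) {n : ℕ} {s : Set (K _⦋n⦌)}
    {t : Set (L _⦋n⦌)} (h : ∀ x ∈ s, f.app _ x ∈ t) {c : Chain K n}
    (hc : c ∈ Finsupp.supported ℤ ℤ s) : chainMap f n c ∈ Finsupp.supported ℤ ℤ t :=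
  map_mem_supported (fun x hx => by
    rw [chainMap_single]
    exact Finsupp.single_mem_supported ℤ _ (h x hx)) hc

section Mesh

variable {n : SimplexCategory}

/-- The barycentric coordinates of a point of a topological simplex. -/
abbrev coords (p : SimplexCategory.toTop.{u}.obj n) : stdSimplex ℝ (Fin (n.len + 1)) := p.down

/-- The tuples of points of a topological simplex with pairwise distances at most `r`. -/
def meshLE (n : SimplexCategory) (m : ℕ) (r : ℝ) :
    Set ((tuples (SimplexCategory.toTop.{u}.obj n)) _⦋m⦌) :=
  {w | ∀ i j : Fin (m + 1), dist (coords (w i)) (coords (w j)) ≤ r}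

lemma range_affineMap_subset {m k : ℕ} {v : (tuples (SimplexCategory.toTop.{u}.obj n)) _⦋m⦌}
    {w : (tuples (SimplexCategory.toTop.{u}.obj n)) _⦋k⦌}
    (h : ∀ j : Fin (k + 1), w j ∈ Set.range (affineMap v)) :
    Set.range (affineMap w) ⊆ Set.range (affineMap v) := by
  choose t ht using h
  rintro _ ⟨s, rfl⟩
  refine ⟨affineMap (n := ⦋m⦌) t s, ?_⟩
  obtain rfl : w = fun j : Fin (k + 1) => affineMap v (t j) := funext fun j => (ht j).symm
  exact congrArg ULift.up (stdSimplex.mix_mix _ _ _).symm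

lemma mem_range_affineMap {m : ℕ} (v : (tuples (SimplexCategory.toTop.{u}.obj n)) _⦋m⦌)
    (j : Fin (m + 1)) : v j ∈ Set.range (affineMap v) :=
  ⟨vertices m j, congrArg ULift.up (stdSimplex.mix_vertex _ j)⟩

lemma div_succ_le_div_succ (m : ℕ) :
    (m : ℝ) / (m + 1) ≤ ((m + 1 : ℕ) : ℝ) / ((m + 1 : ℕ) + 1) := by
  push_cast
  rw [div_le_div_iff₀ (by positivity) (by positivity)]
  nlinarith

/-- Subdivision shrinks the mesh by `m / (m + 1)`. That the new vertices stay in the hull of `v` is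
carried along because the induction must bound their distance to the barycentre of `v`. -/
lemma tuplesSd_single_mem_supported {m : ℕ} {r : ℝ}
    {v : (tuples (SimplexCategory.toTop.{u}.obj n)) _⦋m⦌} (hv : v ∈ meshLE n m r) :
    tuplesSd (barycentre n) m (Finsupp.single v 1) ∈
      Finsupp.supported ℤ ℤ ({w | ∀ j : Fin (m + 1), w j ∈ Set.range (affineMap v)} ∩
        meshLE n m (m / (m + 1) * r)) := by
  induction m with
  | zero =>
    refine Finsupp.single_mem_supported ℤ _ ⟨mem_range_affineMap v, fun i j => ?_⟩
    obtain rfl : i = j := Subsingleton.elim (α := Fin 1) i j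
    simp
  | succ m ih =>
    have hr : 0 ≤ r := dist_nonneg.trans (hv 0 0)
    -- The bound holds at the vertices of `v`, hence on their convex hull. There are `m + 2`
    -- vertices, whence the constant.
    have hb (p : SimplexCategory.toTop.{u}.obj n) (hp : p ∈ Set.range (affineMap v)) :
        dist (coords (barycentre n (m + 1) v)) (coords p) ≤ ((m + 1 : ℕ) : ℝ) / ((m + 1 : ℕ) + 1) * r := by
      obtain ⟨t, rfl⟩ := hp
      exact stdSimplex.dist_mix_le (stdSimplex.dist_mix_barycenter_le hv) _
    rw [tuplesSd_succ_single, boundary_single, map_sum, map_sum]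
    refine sum_mem fun i _ => ?_
    rw [map_smul, map_smul]
    refine Submodule.smul_mem _ _ ?_
    have hδ : ∀ j : Fin (m + 1), (tuples _).δ i v j ∈ Set.range (affineMap v) := fun j => by
      rw [tuples_δ]
      exact mem_range_affineMap v _
    refine map_mem_supported ?_ (ih (v := (tuples _).δ i v) fun j k => hv _ _)
    rintro w ⟨hw, hw'⟩
    have hwv (j : Fin (m + 1)) : w j ∈ Set.range (affineMap v) :=
      range_affineMap_subset hδ (hw j)
    rw [cone_single]
    refine Finsupp.single_mem_supported ℤ _ ⟨fun j => ?_, fun j k => ?_⟩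
    · refine Fin.cases ?_ (fun j => ?_) j
      · exact ⟨_, rfl⟩
      · exact hwv j
    -- Vertex `0` is the barycentre. Pairs containing it are bounded by `hb`; the others come from a
    -- face, whose smaller factor is absorbed by monotonicity.
    · refine Fin.cases ?_ (fun j => ?_) j <;> refine Fin.cases ?_ (fun k => ?_) k
      · rw [dist_self]
        positivity
      · exact hb _ (hwv k)
      · rw [dist_comm]
        exact hb _ (hwv j)
      · exact (hw' j k).trans (mul_le_mul_of_nonneg_right (div_succ_le_div_succ m) hr)

lemma tuplesSd_iterate_mem_supported {m : ℕ} {r : ℝ} (k : ℕ)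
    {c : Chain (tuples (SimplexCategory.toTop.{u}.obj n)) m}
    (hc : c ∈ Finsupp.supported ℤ ℤ (meshLE n m r)) :
    (tuplesSd (barycentre n) m)^[k] c ∈
      Finsupp.supported ℤ ℤ (meshLE n m ((m / (m + 1) : ℝ) ^ k * r)) := by
  induction k with
  | zero => simpa using hc
  | succ k ih =>
    rw [Function.iterate_succ_apply']
    refine map_mem_supported (fun w hw => ?_) ih
    refine Finsupp.supported_mono ?_ (tuplesSd_single_mem_supported hw)
    rw [pow_succ', mul_assoc]
    exact Set.inter_subset_right

end Mesh

section Small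

variable {X : TopCat.{u}} {ι : Type w} (U : ι → Set X)

/-- The continuous map underlying a singular simplex. -/
def simplexHom {n : ℕ} (σ : (TopCat.toSSet.obj X) _⦋n⦌) :
    SimplexCategory.toTop.{u}.obj ⦋n⦌ ⟶ X := σ.down

/-- The singular simplices lying in one of the sets `U i`. -/
def smallSimplices (n : ℕ) : Set ((TopCat.toSSet.obj X) _⦋n⦌) :=
  {σ | ∃ i, ∀ t, simplexHom σ t ∈ U i}

/-- The chains of singular simplices each of which lies in one of the sets `U i`. -/
def smallChains (n : ℕ) : Submodule ℤ (Chain (TopCat.toSSet.obj X) n) :=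
  Finsupp.supported ℤ ℤ (smallSimplices U n)

variable {U}

lemma affineOf_mem_smallSimplices {m n : ℕ} {σ : (TopCat.toSSet.obj X) _⦋n⦌}
    (hσ : σ ∈ smallSimplices U n) (w : (tuples (SimplexCategory.toTop.{u}.obj ⦋n⦌)) _⦋m⦌) :
    (affineOf σ).app _ w ∈ smallSimplices U m := by
  obtain ⟨i, hi⟩ := hσ
  exact ⟨i, fun t => hi (affineMap w t)⟩

lemma singularSd_mem_smallChains {n : ℕ} {c : Chain (TopCat.toSSet.obj X) n}
    (hc : c ∈ smallChains U n) : singularSd X n c ∈ smallChains U n :=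
  map_mem_supported (fun σ hσ => by
    rw [singularSd_single]
    exact chainMap_mem_supported (s := Set.univ) _
      (fun w _ => affineOf_mem_smallSimplices hσ w) (by simp)) hc

lemma singularSdHomotopy_mem_smallChains {n : ℕ} {c : Chain (TopCat.toSSet.obj X) n}
    (hc : c ∈ smallChains U n) : singularSdHomotopy X n c ∈ smallChains U (n + 1) :=
  map_mem_supported (fun σ hσ => by
    rw [singularSdHomotopy_single]
    exact chainMap_mem_supported (s := Set.univ) _
      (fun w _ => affineOf_mem_smallSimplices hσ w) (by simp)) hc

lemma singularSd_iterate_mem_smallChains {n : ℕ} {c : Chain (TopCat.toSSet.obj X) n}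
    (hc : c ∈ smallChains U n) (k : ℕ) : (singularSd X n)^[k] c ∈ smallChains U n := by
  induction k with
  | zero => exact hc
  | succ k ih =>
    rw [Function.iterate_succ_apply']
    exact singularSd_mem_smallChains ih

lemma singularSd_iterate_chainMap {n : ℕ} (σ : (TopCat.toSSet.obj X) _⦋n⦌) (k : ℕ)
    (c : Chain (tuples (SimplexCategory.toTop.{u}.obj ⦋n⦌)) n) :
    (singularSd X n)^[k] (chainMap (affineOf σ) n c) =
      chainMap (affineOf σ) n ((tuplesSd (barycentre ⦋n⦌) n)^[k] c) := by
  induction k with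
  | zero => rfl
  | succ k ih => rw [Function.iterate_succ_apply', ih, singularSd_chainMap,
      Function.iterate_succ_apply']

lemma exists_singularSd_iterate_single_mem_smallChains (hU : ∀ i, IsOpen (U i)) (hcover : ⋃ i, U i = Set.univ)
    {n : ℕ}
    (σ : (TopCat.toSSet.obj X) _⦋n⦌) :
    ∃ k, (singularSd X n)^[k] (Finsupp.single σ 1) ∈ smallChains U n := by
  let f : stdSimplex ℝ (Fin (n + 1)) → X := fun t => simplexHom σ (ULift.up t)
  have hf : Continuous f := (simplexHom σ).hom.continuous.comp continuous_uliftUp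
  -- A Lebesgue number of the cover pulled back to the compact simplex: it suffices to subdivide
  -- until the mesh is below `ε`.
  obtain ⟨ε, hε, h⟩ := lebesgue_number_lemma_of_metric (isCompact_univ (X := stdSimplex ℝ (Fin (n + 1))))
    (c := fun i => f ⁻¹' U i) (fun i => (hU i).preimage hf) (by
      rw [← Set.preimage_iUnion, hcover, Set.preimage_univ])
  obtain ⟨r, hr⟩ : ∃ r, vertices.{u} n ∈ meshLE ⦋n⦌ n r :=
    ⟨Metric.diam (Set.univ : Set (stdSimplex ℝ (Fin (n + 1)))), fun i j =>
      Metric.dist_le_diam_of_mem isCompact_univ.isBounded (Set.mem_univ _) (Set.mem_univ _)⟩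
  have hlim : Filter.Tendsto (fun k : ℕ => (n / (n + 1) : ℝ) ^ k * r) Filter.atTop (nhds 0) := by
    simpa using (tendsto_pow_atTop_nhds_zero_of_lt_one (r := (n / (n + 1) : ℝ)) (by positivity)
      ((div_lt_one (by positivity)).2 (by linarith))).mul_const r
  obtain ⟨k, hk⟩ := (hlim.eventually_lt_const hε).exists
  refine ⟨k, ?_⟩
  rw [single_eq_chainMap, singularSd_iterate_chainMap]
  refine chainMap_mem_supported _ (fun w hw => ?_)
    (tuplesSd_iterate_mem_supported k (Finsupp.single_mem_supported ℤ _ hr))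
  -- All vertices are close to vertex `0`, and by convexity so is the whole affine simplex; it lies
  -- in one `ε`-ball.
  obtain ⟨i, hi⟩ := h (coords (w (0 : Fin (n + 1)))) (Set.mem_univ _)
  refine ⟨i, fun t => hi ?_⟩
  rw [Metric.mem_ball, dist_comm]
  exact (stdSimplex.dist_mix_le (fun j => hw 0 j) t.down).trans_lt hk

lemma exists_singularSd_iterate_mem_smallChains (hU : ∀ i, IsOpen (U i)) (hcover : ⋃ i, U i = Set.univ)
    {n : ℕ} (c : Chain (TopCat.toSSet.obj X) n) :
    ∃ k, (singularSd X n)^[k] c ∈ smallChains U n := by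
  induction c using Finsupp.induction_linear with
  | zero => exact ⟨0, zero_mem _⟩
  | add c c' hc hc' =>
    obtain ⟨k, hk⟩ := hc
    obtain ⟨k', hk'⟩ := hc'
    -- Further subdivision keeps a small chain small, so the sum of the exponents serves both
    -- summands.
    refine ⟨k' + k, ?_⟩
    rw [iterate_map_add]
    refine add_mem ?_ ?_
    · rw [Function.iterate_add_apply]
      exact singularSd_iterate_mem_smallChains hk _
    · rw [add_comm, Function.iterate_add_apply]
      exact singularSd_iterate_mem_smallChains hk' _
  | single σ a =>
    obtain ⟨k, hk⟩ := exists_singularSd_iterate_single_mem_smallChains hU hcover σ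
    refine ⟨k, ?_⟩
    rw [← mul_one a, ← smul_eq_mul, ← Finsupp.smul_single, iterate_map_zsmul]
    exact Submodule.smul_mem _ _ hk

/-- The relative homology of a space modulo small chains vanishes. -/
lemma exists_sub_boundary_mem_smallChains (hU : ∀ i, IsOpen (U i)) (hcover : ⋃ i, U i = Set.univ)
    {n : ℕ} {z : Chain (TopCat.toSSet.obj X) (n + 1)}
    (hz : boundary _ n z ∈ smallChains U n) :
    ∃ c, z - boundary _ (n + 1) c ∈ smallChains U (n + 1) := by
  obtain ⟨k, hk⟩ := exists_singularSd_iterate_mem_smallChains hU hcover z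
  induction k generalizing z with
  | zero => exact ⟨0, by simpa using hk⟩
  | succ k ih =>
    obtain ⟨c, hc⟩ := ih (z := singularSd X (n + 1) z) (by
      rw [boundary_singularSd]
      exact singularSd_mem_smallChains hz) (by rwa [Function.iterate_succ_apply] at hk)
    -- With `T` the subdivision homotopy, `z - Sd z = ∂Tz + T∂z`, and `T∂z` is small because `∂z`
    -- is.
    refine ⟨c + singularSdHomotopy X (n + 1) z, ?_⟩
    have e : z - boundary _ (n + 1) (c + singularSdHomotopy X (n + 1) z) =
        (singularSd X (n + 1) z - boundary _ (n + 1) c) +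
          singularSdHomotopy X n (boundary _ n z) := by
      rw [map_add, boundary_singularSdHomotopy]
      abel
    rw [e]
    exact add_mem hc (singularSdHomotopy_mem_smallChains hz)

/-- A chain homotopy moving the boundaries of singular chains to small chains. -/
lemma exists_homotopy_to_smallChains (hU : ∀ i, IsOpen (U i)) (hcover : ⋃ i, U i = Set.univ)
    (n : ℕ) :
    ∃ D : Chain (TopCat.toSSet.obj X) n →ₗ[ℤ] Chain (TopCat.toSSet.obj X) (n + 1),
      ∀ z, boundary _ n (z - D (boundary _ n z)) ∈ smallChains U n := by
  induction n with
  | zero =>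
    have h (c : Chain (TopCat.toSSet.obj X) 0) : c ∈ smallChains U 0 := by
      refine Finsupp.supported_mono (s := Set.univ) (fun σ _ => ?_) (by simp)
      have hx : simplexHom σ default ∈ ⋃ i, U i := hcover ▸ Set.mem_univ _
      obtain ⟨i, hi⟩ := Set.mem_iUnion.1 hx
      exact ⟨i, fun t => by rwa [Subsingleton.elim t default]⟩
    exact ⟨0, fun z => h _⟩
  | succ n ih =>
    obtain ⟨D, hD⟩ := ih
    -- By induction `σ - D ∂σ` has small boundary, so a further boundary makes it small. Choosing on
    -- the basis and extending linearly yields an additive homotopy.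
    choose D' hD' using fun σ : (TopCat.toSSet.obj X) _⦋n + 1⦌ =>
      exists_sub_boundary_mem_smallChains hU hcover (hD (Finsupp.single σ 1))
    let D'' := Finsupp.linearCombination ℤ D'
    have h (c : Chain (TopCat.toSSet.obj X) (n + 1)) :
        c - D (boundary _ n c) - boundary _ (n + 1) (D'' c) ∈ smallChains U (n + 1) := by
      refine map_mem_supported
        (f := LinearMap.id - D ∘ₗ boundary _ n - boundary _ (n + 1) ∘ₗ D'') (s := Set.univ)
        (fun σ _ => ?_) (by simp)
      have e : D'' (Finsupp.single σ 1) = D' σ := by simp [D'']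
      simp only [LinearMap.sub_apply, LinearMap.id_apply, LinearMap.comp_apply, e]
      exact hD' σ
    refine ⟨D'', fun z => ?_⟩
    have := h (boundary _ (n + 1) z)
    rwa [boundary_boundary, map_zero, sub_zero, ← map_sub] at this

/-- A cocycle that vanishes on the small simplices is a coboundary. -/
theorem mem_coboundaries_of_eq_zero_on_smallSimplices (hU : ∀ i, IsOpen (U i)) (hcover : ⋃ i, U i = Set.univ)
    {R : Type v} [Ring R] {n : ℕ}
    {φ : Cochain (TopCat.toSSet.obj X) R n} (hφ : φ ∈ cocycles _ R n)
    (h0 : ∀ σ ∈ smallSimplices U n, φ σ = 0) : φ ∈ coboundaries _ R n := by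
  cases n with
  | zero =>
    change φ = 0
    ext σ
    have hx : simplexHom σ default ∈ ⋃ i, U i := hcover ▸ Set.mem_univ _
    obtain ⟨i, hi⟩ := Set.mem_iUnion.1 hx
    exact h0 σ ⟨i, fun t => by rwa [Subsingleton.elim t default]⟩
  | succ n =>
    obtain ⟨D, hD⟩ := exists_homotopy_to_smallChains hU hcover n
    have hd : d _ R (n + 1) φ = 0 := hφ
    have e : pairing (fun σ => pairing φ (D (Finsupp.single σ 1))) = pairing φ ∘ₗ D :=
      chain_hom_ext fun x => by simp
    refine ⟨fun σ => pairing φ (D (Finsupp.single σ 1)), ?_⟩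
    ext σ
    -- The chain `σ - D ∂σ` is small up to the boundary of `c`. Since `φ` kills both small chains
    -- and boundaries, `φ σ = φ (D ∂σ)`, which is the coboundary of `φ ∘ D` at `σ`.
    obtain ⟨c, hc⟩ := exists_sub_boundary_mem_smallChains hU hcover (hD (Finsupp.single σ 1))
    have h1 := pairing_eq_zero_of_mem_supported h0 hc
    rw [map_sub, map_sub, ← pairing_d, hd, pairing_single,
      pairing_eq_zero_of_mem_supported (s := Set.univ) (φ := 0) (by simp) (by simp), sub_zero,
      sub_eq_zero] at h1
    rw [← pairing_single (d _ R n _) σ, pairing_d, e, LinearMap.comp_apply, h1]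

end Small

end SimplicialCohomology

end

/-! ### Cocycles vanishing on subcomplexes, and their cup products. -/

noncomputable section

namespace SimplicialCohomology

open CategoryTheory Opposite

open scoped Simplicial

section Vanishing

variable {K : SSet.{u}} {R : Type v} [Ring R]

/-- The degree `n` classes represented by cocycles that vanish on a subcomplex. -/
def vanishingClasses (A : K.Subcomplex) (n : ℕ) : AddSubgroup (Cohomology K R n) where
  carrier := {a | ∃ φ : cocycles K R n, Cohomology.mk K R n φ = a ∧
    ∀ x ∈ A.obj (op ⦋n⦌), φ.1 x = 0}
  zero_mem' := ⟨0, map_zero _, fun _ _ => rfl⟩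
  add_mem' := by
    rintro _ _ ⟨φ, rfl, hφ⟩ ⟨ψ, rfl, hψ⟩
    refine ⟨φ + ψ, map_add _ _ _, fun x hx => ?_⟩
    change φ.1 x + ψ.1 x = 0
    rw [hφ x hx, hψ x hx, add_zero]
  neg_mem' := by
    rintro _ ⟨φ, rfl, hφ⟩
    refine ⟨-φ, map_neg _ _, fun x hx => ?_⟩
    change -φ.1 x = 0
    rw [hφ x hx, neg_zero]

/-- The elements of the cohomology ring all of whose components are represented by cocycles that
vanish on a subcomplex. -/
def vanishing (R : Type v) [Ring R] (A : K.Subcomplex) :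
    AddSubgroup (DirectSum ℕ (Cohomology K R)) :=
  ⨅ n, (vanishingClasses A n).comap (DFinsupp.evalAddMonoidHom n)

lemma mem_vanishing {A : K.Subcomplex} {a : DirectSum ℕ (Cohomology K R)} :
    a ∈ vanishing R A ↔ ∀ n, a n ∈ vanishingClasses A n := by
  simp only [vanishing, AddSubgroup.mem_iInf, AddSubgroup.mem_comap]
  rfl

lemma of_mem_vanishing {A : K.Subcomplex} {n : ℕ} {a : Cohomology K R n}
    (ha : a ∈ vanishingClasses A n) : DirectSum.of (Cohomology K R) n a ∈ vanishing R A := by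
  rw [mem_vanishing]
  intro m
  rw [DirectSum.of_apply]
  split_ifs with h
  · subst h
    exact ha
  · exact zero_mem _

lemma seg_mem (A : K.Subcomplex) {p n a : ℕ} (h : a + p ≤ n) {x : K _⦋n⦌}
    (hx : x ∈ A.obj (op ⦋n⦌)) : seg K a h x ∈ A.obj (op ⦋p⦌) :=
  A.map _ hx

/-- For a simplex in `A` the front face lies in `A`; for a simplex in `B` the back face lies in `B`.
Either way one factor of the cochain product is zero. -/
lemma cup_mem_vanishingClasses {A B : K.Subcomplex} {p q n : ℕ} (h : p + q = n)
    {a : Cohomology K R p} {b : Cohomology K R q} (ha : a ∈ vanishingClasses A p)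
    (hb : b ∈ vanishingClasses B q) : Cohomology.cup h a b ∈ vanishingClasses (A ⊔ B) n := by
  obtain ⟨φ, rfl, hφ⟩ := ha
  obtain ⟨ψ, rfl, hψ⟩ := hb
  refine ⟨cocycleCup h φ ψ, rfl, fun x hx => ?_⟩
  change φ.1 (seg K 0 _ x) * ψ.1 (seg K p _ x) = 0
  rcases hx with hx | hx
  · rw [hφ _ (seg_mem A _ hx), zero_mul]
  · rw [hψ _ (seg_mem B _ hx), mul_zero]

lemma mul_mem_vanishing {A B : K.Subcomplex} {a b : DirectSum ℕ (Cohomology K R)}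
    (ha : a ∈ vanishing R A) (hb : b ∈ vanishing R B) : a * b ∈ vanishing R (A ⊔ B) := by
  classical
  rw [← DirectSum.sum_support_of a, ← DirectSum.sum_support_of b, Finset.sum_mul_sum]
  refine sum_mem fun i _ => sum_mem fun j _ => ?_
  rw [DirectSum.of_mul_of]
  exact of_mem_vanishing (cup_mem_vanishingClasses rfl (mem_vanishing.1 ha i)
    (mem_vanishing.1 hb j))

lemma vanishing_antitone {A B : K.Subcomplex} (h : A ≤ B) : vanishing R B ≤ vanishing R A := by
  intro a ha
  rw [mem_vanishing] at ha ⊢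
  intro n
  obtain ⟨φ, hφ, h0⟩ := ha n
  exact ⟨φ, hφ, fun x hx => h0 x (h _ hx)⟩

lemma mem_vanishing_bot (a : DirectSum ℕ (Cohomology K R)) : a ∈ vanishing R ⊥ := by
  rw [mem_vanishing]
  intro n
  obtain ⟨φ, hφ⟩ := Cohomology.mk_surjective n (a n)
  exact ⟨φ, hφ, fun x hx => hx.elim⟩

lemma prod_mem_vanishing {k : ℕ} {a : Fin k → DirectSum ℕ (Cohomology K R)}
    {A : Fin k → K.Subcomplex} (h : ∀ i, a i ∈ vanishing R (A i)) :
    (List.ofFn a).prod ∈ vanishing R (⨆ i, A i) := by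
  induction k with
  -- The empty supremum has no simplices, so vanishing there is no condition on the empty product.
  | zero => exact vanishing_antitone (iSup_le fun i => i.elim0) (mem_vanishing_bot (R := R) _)
  | succ k ih =>
    rw [List.ofFn_succ, List.prod_cons]
    have hle : ⨆ i, A i ≤ A 0 ⊔ ⨆ i : Fin k, A i.succ := iSup_le fun i => by
      refine Fin.cases le_sup_left (fun i => ?_) i
      exact le_sup_of_le_right (le_iSup (fun i : Fin k => A i.succ) i)
    refine vanishing_antitone hle ?_
    exact mul_mem_vanishing (h 0) (ih fun i => h i.succ)

/-- A class that restricts to zero on a simplicial subset is represented by a cocycle that vanishes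
there. -/
lemma mem_vanishingClasses_range {L : SSet.{u}} (f : L ⟶ K) {n : ℕ}
    (hf : ∀ n, Function.Injective (f.app (op ⦋n⦌))) {a : Cohomology K R n}
    (ha : Cohomology.map R f n a = 0) : a ∈ vanishingClasses (SSet.Subcomplex.range f) n := by
  obtain ⟨φ, rfl⟩ := Cohomology.mk_surjective n a
  rw [Cohomology.map_mk _ _ _ (cochainMap_mem_cocycles f φ.2), Cohomology.mk_eq_zero_iff] at ha
  cases n with
  | zero =>
    refine ⟨φ, rfl, ?_⟩
    rintro _ ⟨x, rfl⟩
    exact congrFun (show cochainMap R f 0 φ.1 = 0 from ha) x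
  | succ n =>
    obtain ⟨θ, hθ⟩ := ha
    -- Extension by zero along the injection. It need not be a cocycle, but subtracting its
    -- coboundary preserves the class and cancels `φ` on the range of `f`.
    let θ' : Cochain K R n := Function.extend (f.app (op ⦋n⦌)) θ 0
    have e : cochainMap R f n θ' = θ := funext fun x => (hf n).extend_apply θ 0 x
    have hb : d K R n θ' ∈ coboundaries K R (n + 1) := ⟨θ', rfl⟩
    have hc : d K R n θ' ∈ cocycles K R (n + 1) := by
      change d K R (n + 1) (d K R n θ') = 0
      ext x
      rw [← pairing_single (d K R (n + 1) _) x, pairing_d, pairing_d, boundary_boundary, map_zero]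
      rfl
    refine ⟨φ - ⟨_, hc⟩, ?_, ?_⟩
    · rw [map_sub, (Cohomology.mk_eq_zero_iff ⟨_, hc⟩).2 hb, sub_zero]
    · rintro _ ⟨x, rfl⟩
      have h1 : d L R n (cochainMap R f n θ') x = cochainMap R f (n + 1) φ.1 x := by
        rw [e, hθ]
      rw [d_cochainMap] at h1
      change φ.1 (f.app _ x) - d K R n θ' (f.app _ x) = 0
      exact sub_eq_zero.2 h1.symm

end Vanishing

/-! ### Open covers, sections of the endpoint map and the cup length bound. -/

/-- The inclusion of a subset of a space, as a map of singular simplicial sets. -/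
abbrev singularInclusion {X : Type u} [TopologicalSpace X] (U : Set X) :
    TopCat.toSSet.obj (TopCat.of U) ⟶ TopCat.toSSet.obj (TopCat.of X) :=
  TopCat.toSSet.map (TopCat.ofHom ⟨Subtype.val, continuous_subtype_val⟩)

lemma singularInclusion_injective {X : Type u} [TopologicalSpace X] (U : Set X) (n : ℕ) :
    Function.Injective ((singularInclusion U).app (op ⦋n⦌)) := by
  intro σ τ h
  apply ULift.ext
  refine TopCat.hom_ext (ContinuousMap.ext fun t => Subtype.ext ?_)
  exact DFunLike.congr_fun (congrArg (fun σ => (simplexHom σ).hom) h) t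

lemma mem_range_singularInclusion {X : Type u} [TopologicalSpace X] {U : Set X} {n : ℕ}
    {σ : (TopCat.toSSet.obj (TopCat.of X)) _⦋n⦌} (h : ∀ t, simplexHom σ t ∈ U) :
    σ ∈ (SSet.Subcomplex.range (singularInclusion U)).obj (op ⦋n⦌) :=
  ⟨ULift.up (TopCat.ofHom ⟨fun t => ⟨simplexHom σ t, h t⟩,
    (simplexHom σ).hom.continuous.subtype_mk _⟩), rfl⟩

/-- If each element of an open cover has one of the `aᵢ` restricting to zero on it, then the product
of the `aᵢ` vanishes. -/
theorem prod_eq_zero_of_cover {X : Type u} [TopologicalSpace X] {R : Type v} [Ring R] {k : ℕ}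
    (a : Fin k → SingularCohomologyRing X R) (U : Fin k → Set X) (hU : ∀ i, IsOpen (U i))
    (hcover : ⋃ i, U i = Set.univ)
    (h : ∀ i n, Cohomology.map R (singularInclusion (U i)) n (a i n) = 0) :
    (List.ofFn a).prod = 0 := by
  have := prod_mem_vanishing (a := a)
    (A := fun i => SSet.Subcomplex.range (singularInclusion (U i)))
    fun i => mem_vanishing.2 fun n =>
      mem_vanishingClasses_range _ (singularInclusion_injective _) (h i n)
  rw [mem_vanishing] at this
  refine DFinsupp.ext fun n => ?_
  obtain ⟨φ, hφ, h0⟩ := this n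
  rw [← hφ]
  refine (Cohomology.mk_eq_zero_iff φ).2
    (mem_coboundaries_of_eq_zero_on_smallSimplices (X := TopCat.of X) hU hcover φ.2 ?_)
  rintro σ ⟨i, hi⟩
  exact h0 σ ((le_iSup (fun i => SSet.Subcomplex.range (singularInclusion (U i))) i) _
    (mem_range_singularInclusion hi))

/-- Over a set with a section of the endpoint map, the inclusion into the fibre product factors
up to homotopy through the diagonal. -/
lemma map_singularInclusion_eq_zero {E : Type u} {B : Type v} [TopologicalSpace E] {p : E → B}
    {R : Type w} [Ring R] {U : Set (Function.Pullback p p)} (s : C(U, FibrePath p))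
    (hs : ∀ x : U, endpoints p (s x) = x) {n : ℕ}
    {a : SingularCohomology (Function.Pullback p p) R n}
    (ha : Cohomology.map R (TopCat.toSSet.map (TopCat.ofHom (fibreDiagonal p))) n a = 0) :
    Cohomology.map R (singularInclusion U) n a = 0 := by
  let q : C(U, E) := ⟨fun x => (s x).1 0, by fun_prop⟩
  -- The first point stays at the start of the path while the second runs along it; the pair remains
  -- in the fibre product because the path lies in one fibre.
  let H : ContinuousMap.Homotopy ((fibreDiagonal p).comp q)
      ⟨(Subtype.val : U → Function.Pullback p p), continuous_subtype_val⟩ :=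
    { toFun := fun z => ⟨((s z.2).1 0, (s z.2).1 z.1), (s z.2).2 0 z.1⟩
      continuous_toFun := by fun_prop
      map_zero_left := fun x => rfl
      map_one_left := fun x => hs x }
  have hH := TopCat.Homotopy.toSSet (f := TopCat.ofHom q ≫ TopCat.ofHom (fibreDiagonal p))
    (g := TopCat.ofHom ⟨(Subtype.val : U → Function.Pullback p p), continuous_subtype_val⟩) H
  rw [← Cohomology.map_eq_of_homotopy hH, Functor.map_comp, Cohomology.map_comp, ha, map_zero]

end SimplicialCohomology

end

theorem proposition7p3 {E : Type u} {B : Type v} [TopologicalSpace E] [TopologicalSpace B]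
    (p : E → B) (hp : IsHurewiczFibration p) (hfib : ∀ b : B, IsPathConnected (p ⁻¹' {b}))
    (R : Type w) [Ring R] :
    cupLength {a : SingularCohomologyRing (Function.Pullback p p) R |
        SingularCohomologyRing.map R (fibreDiagonal p) a = 0} ≤ parametrisedTC p ∧
    ∀ (k : ℕ) (a : Fin k → SingularCohomologyRing (Function.Pullback p p) R),
      (∀ i, SingularCohomologyRing.map R (fibreDiagonal p) (a i) = 0) →
      (List.ofFn a).prod ≠ 0 → (k : ℕ∞) ≤ parametrisedTC p := by
  have key : ∀ (k : ℕ) (a : Fin k → SingularCohomologyRing (Function.Pullback p p) R),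
      (∀ i, SingularCohomologyRing.map R (fibreDiagonal p) (a i) = 0) →
      (List.ofFn a).prod ≠ 0 → (k : ℕ∞) ≤ parametrisedTC p := by
    intro k a ha hprod
    refine le_sInf ?_
    rintro _ ⟨l, U, hU, hcover, hs, rfl⟩
    by_contra! hlt
    have hlk : l < k := by exact_mod_cast hlt
    -- Since `l + 1 ≤ k`, repeating the last set indexes the cover by `Fin k`, one set for each
    -- factor.
    refine hprod (SimplicialCohomology.prod_eq_zero_of_cover a
      (fun i => U ⟨min i l, by omega⟩) (fun i => hU _) ?_ fun i n => ?_)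
    · rw [Set.eq_univ_iff_forall]
      intro x
      obtain ⟨j, hj⟩ := Set.mem_iUnion.1 (hcover ▸ Set.mem_univ x : x ∈ ⋃ i, U i)
      refine Set.mem_iUnion.2 ⟨⟨j, by omega⟩, ?_⟩
      convert hj
      simp only
      omega
    · obtain ⟨s, hs⟩ := hs ⟨min i l, by omega⟩
      exact SimplicialCohomology.map_singularInclusion_eq_zero s hs
        (DFunLike.congr_fun (ha i) n)
  refine ⟨sSup_le ?_, key⟩
  rintro _ ⟨k, a, ha, hprod, rfl⟩
  exact key k a ha hprod
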